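/- Let $(M,g_0)$ be a connected closed (compact, without boundary) smooth Riemannian manifold of dimension $n$, with Riemannian distance $d_0$ and Riemannian volume measure $\mu_0$. Let $C,V>0$, $R_0\in(0,\operatorname{diam}(M,g_0)]$ and $q>1$. Let $\mathcal M_{V,R_0,q,C}$ be the set of smooth functions $f:M\to\mathbb R$ such that 1. the metric $g_f=e^{2f}g_0$ satisfies $\operatorname{vol}(M,g_f)\le V$; 2. the weight $w=e^{nf}$ satisfies, for every $g_0$-geodesic ball $B\subset M$ of radius at most $R_0$, the reverse Hölder inequality $$\left(\frac1{\mu_0(B)}\int_B w^q\,d\mu_0\right)^{1/q}\le \frac{C}{\mu_0(B)}\int_B w\,d\mu_0 .$$ For $f\in\mathcal M_{V,R_0,q,C}$ let $d_f$ be the Riemannian distance of $g_f$. Then for every $\alpha\in(0,1-\frac1q)$ the set $\{d_f : f\in\mathcal M_{V,R_0,q,C}\}$ is a relatively compact subset of the Hölder space $C^\alpha(M\times M)$, where Hölder continuity on $M\times M$ is measured with the product of the distances $d_0$ and $C^\alpha(M\times M)$ carries the norm $\|u\|_\infty+[u]_\alpha$. Moreover, the set of metric spaces $\{(M,d_f)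 : f\in\mathcal M_{V,R_0,q,C}\}$ is relatively compact in the space of isometry classes of nonempty compact metric spaces with the Gromov–Hausdorff distance. -/

import Mathlib

open Bundle Manifold MeasureTheory Set Filter Topology
open scoped ContDiff NNReal ENNReal

noncomputable section

namespace ConformalGeometry

/-- A smooth Riemannian metric on an `n`-dimensional smooth manifold `M` (without boundary). -/
abbrev SmoothMetric (n : ℕ) (M : Type*) [TopologicalSpace M]
    [ChartedSpace (EuclideanSpace ℝ (Fin n)) M] [IsManifold (𝓡 n) ∞ M] : Type _ :=
  ContMDiffRiemannianMetric (𝓡 n) ∞ (EuclideanSpace ℝ (Fin n))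
    (fun x : M => TangentSpace (𝓡 n) x)

section Metric

variable {n : ℕ} {M : Type*} [TopologicalSpace M]
  [ChartedSpace (EuclideanSpace ℝ (Fin n)) M] [IsManifold (𝓡 n) ∞ M]

set_option synthInstance.maxHeartbeats 400000 in
/-- The conformal metric `e^{2f} g`. -/
def conformal (g : SmoothMetric n M) (f : C^∞⟮𝓡 n, M; 𝓘(ℝ, ℝ), ℝ⟯) : SmoothMetric n M where
  inner x := Real.exp (2 * f x) • g.inner x
  symm x v w := by
    change Real.exp (2 * f x) * g.inner x v w = Real.exp (2 * f x) * g.inner x w v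
    rw [g.symm]
  pos x v hv := by
    change 0 < Real.exp (2 * f x) * g.inner x v v
    exact mul_pos (Real.exp_pos _) (g.pos x v hv)
  isVonNBounded x := by
    have h := (g.isVonNBounded x).image
      ((Real.exp (f x))⁻¹ • ContinuousLinearMap.id ℝ (TangentSpace (𝓡 n) x))
    refine h.subset ?_
    intro v hv
    have hv' : Real.exp (2 * f x) * g.inner x v v < 1 := hv
    refine ⟨Real.exp (f x) • v, ?_, ?_⟩
    · change g.inner x (Real.exp (f x) • v) (Real.exp (f x) • v) < 1
      have : g.inner x (Real.exp (f x) • v) (Real.exp (f x) • v)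
          = Real.exp (2 * f x) * g.inner x v v := by
        rw [two_mul, Real.exp_add]
        simp [mul_assoc]
      rwa [this]
    · change (Real.exp (f x))⁻¹ • (Real.exp (f x) • v) = v
      rw [smul_smul, inv_mul_cancel₀ (Real.exp_pos _).ne', one_smul]
  contMDiff := by
    have h : ContMDiff (𝓡 n) 𝓘(ℝ, ℝ) ∞ (fun x : M => Real.exp (2 * f x)) :=
      (Real.contDiff_exp.comp (contDiff_const.mul contDiff_id)).contMDiff.comp f.contMDiff
    exact h.smul_section g.contMDiff

/-- The Riemannian (extended) distance of `g`: the infimum of the `g`-lengths of `C^1` paths. -/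
def riemEDist (g : SmoothMetric n M) (x y : M) : ℝ≥0∞ :=
  letI : RiemannianBundle (fun x : M => TangentSpace (𝓡 n) x) := ⟨g.toRiemannianMetric⟩
  riemannianEDist (𝓡 n) x y

/-- The Riemannian distance `d_g`. -/
def riemDist (g : SmoothMetric n M) (x y : M) : ℝ := (riemEDist g x y).toReal

/-- The open geodesic ball of `g` with centre `x` and radius `r`. -/
def geodesicBall (g : SmoothMetric n M) (x : M) (r : ℝ) : Set M := {y | riemDist g x y < r}

/-- The point set `M`, regarded as a metric space with the Riemannian distance of `g`. -/
@[nolint unusedArguments]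
def RiemSpace (_g : SmoothMetric n M) : Type _ := M

variable [T2Space M] [CompactSpace M]

/-- The extended metric space `(M, d_g)`; its topology is the manifold topology. -/
@[reducible] def riemEMetricSpace (g : SmoothMetric n M) : EMetricSpace M :=
  letI : RiemannianBundle (fun x : M => TangentSpace (𝓡 n) x) := ⟨g.toRiemannianMetric⟩
  haveI : IsContinuousRiemannianBundle (EuclideanSpace ℝ (Fin n))
      (fun x : M => TangentSpace (𝓡 n) x) :=
    ⟨g.inner, g.contMDiff.continuous, fun _ _ _ => rfl⟩
  EMetricSpace.ofRiemannianMetric (𝓡 n) M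

theorem riemEDist_ne_top [ConnectedSpace M] (g : SmoothMetric n M) (x y : M) :
    riemEDist g x y ≠ ⊤ := by
  let := riemEMetricSpace g
  have h : IsClopen (Metric.eball x (⊤ : ℝ≥0∞)) :=
    ⟨Metric.isClosed_eball_top, Metric.isOpen_eball⟩
  have h2 : y ∈ Metric.eball x (⊤ : ℝ≥0∞) := by
    rw [h.eq_univ ⟨x, by simp⟩]
    trivial
  have h3 : edist x y < ⊤ := by
    rw [edist_comm]
    exact h2
  exact h3.ne

instance [ConnectedSpace M] (g : SmoothMetric n M) : MetricSpace (RiemSpace g) :=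
  @EMetricSpace.toMetricSpace M (riemEMetricSpace g) (fun x y => riemEDist_ne_top g x y)

instance [ConnectedSpace M] (g : SmoothMetric n M) : CompactSpace (RiemSpace g) :=
  inferInstanceAs (CompactSpace M)

instance [ConnectedSpace M] (g : SmoothMetric n M) : Nonempty (RiemSpace g) :=
  inferInstanceAs (Nonempty M)

theorem dist_riemSpace [ConnectedSpace M] (g : SmoothMetric n M) (x y : RiemSpace g) :
    dist x y = riemDist g x y := rfl

end Metric

section Volume

variable {n : ℕ} {M : Type*} [TopologicalSpace M]
  [ChartedSpace (EuclideanSpace ℝ (Fin n)) M] [IsManifold (𝓡 n) ∞ M]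

/-- The matrix `g_{ij}(z)` of the metric in the chart at `c`, at the point `z` of the target of
that chart: `g_{ij} = g(∂_i, ∂_j)`. -/
def gramMatrix (g : SmoothMetric n M) (c : M) (z : EuclideanSpace ℝ (Fin n)) :
    Matrix (Fin n) (Fin n) ℝ :=
  let φ := chartAt (EuclideanSpace ℝ (Fin n)) c
  Matrix.of fun i j => g.inner (φ.symm z)
    (mfderiv (𝓡 n) (𝓡 n) φ.symm z (EuclideanSpace.single i (1 : ℝ)))
    (mfderiv (𝓡 n) (𝓡 n) φ.symm z (EuclideanSpace.single j (1 : ℝ)))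

variable [MeasurableSpace M]

/-- The Riemannian measure `√(det g_{ij}) dz` on the domain of the chart at `c`, as a measure
on `M` that vanishes outside that domain. -/
def chartVolume (g : SmoothMetric n M) (c : M) : Measure M :=
  let φ := chartAt (EuclideanSpace ℝ (Fin n)) c
  ((volume.restrict φ.target).withDensity
    fun z => ENNReal.ofReal √(gramMatrix g c z).det).map φ.symm

variable (n M) in
/-- A smooth partition of unity on `M`, indexed by the points of `M`, the support of the
function of index `c` being contained in the domain of the chart at `c`. -/
def chartPartition [T2Space M] [CompactSpace M] : SmoothPartitionOfUnity M (𝓡 n) M univ :=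
  (SmoothPartitionOfUnity.exists_isSubordinate_chartAt_source (𝓡 n) M).choose

/-- The Riemannian volume measure of `g`, i.e. `∫ h dμ_g = ∑_c ∫ ρ_c h √(det g_{ij}) dz`, with
`ρ` a smooth partition of unity subordinate to the charts. (By the change of variables formula
the result does not depend on the choice of `ρ`.) -/
def riemVolume [T2Space M] [CompactSpace M] (g : SmoothMetric n M) : Measure M :=
  Measure.sum fun c : M =>
    (chartVolume g c).withDensity fun y => ENNReal.ofReal (chartPartition n M c y)

end Volume

section Holder

/-- The space `C^α(X)` of bounded continuous functions on `X` that are `α`-Hölder. -/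
structure HolderSpace (α : ℝ≥0) (X : Type*) [MetricSpace X] where
  toFun : BoundedContinuousFunction X ℝ
  memHolder : MemHolder α toFun

variable {α : ℝ≥0} {X : Type*} [MetricSpace X]

instance : CoeFun (HolderSpace α X) fun _ => X → ℝ := ⟨fun u => u.toFun⟩

theorem HolderSpace.memHolder_sub (u v : HolderSpace α X) :
    MemHolder α (fun x => u x - v x) := by
  have h := u.memHolder.add (v.memHolder.smul (c := (-1 : ℝ)))
  have e : (fun x => u x - v x) = (u.toFun : X → ℝ) + (-1 : ℝ) • (v.toFun : X → ℝ) := by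
    funext x
    simp [sub_eq_add_neg]
  rw [e]
  exact h

/-- The distance of the `C^α` norm: `‖u - v‖_∞ + [u - v]_α`, where `[·]_α` is the Hölder
seminorm. -/
instance : MetricSpace (HolderSpace α X) where
  dist u v := dist u.toFun v.toFun + nnHolderNorm α (fun x => u x - v x)
  dist_self u := by
    have e : (fun x => u x - u x) = (0 : X → ℝ) := by
      funext x
      simp
    rw [e]
    simp
  dist_comm u v := by
    have e : (fun x => v x - u x) = (-1 : ℝ) • (fun x => u x - v x) := by
      funext x
      simp
    rw [dist_comm, e, (u.memHolder_sub v).nnHolderNorm_smul]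
    simp
  dist_triangle u v w := by
    have e : (fun x => u x - w x) = (fun x => u x - v x) + (fun x => v x - w x) := by
      funext x
      simp
    have h1 := dist_triangle u.toFun v.toFun w.toFun
    have h2 : (nnHolderNorm α (fun x => u x - w x) : ℝ) ≤
        nnHolderNorm α (fun x => u x - v x) + nnHolderNorm α (fun x => v x - w x) := by
      rw [e]
      exact_mod_cast (u.memHolder_sub v).nnHolderNorm_add_le (v.memHolder_sub w)
    linarith
  eq_of_dist_eq_zero := by
    intro u v h
    have h1 : dist u.toFun v.toFun = 0 :=
      le_antisymm (h ▸ le_add_of_nonneg_right (NNReal.coe_nonneg _)) dist_nonneg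
    cases u
    cases v
    congr
    exact dist_eq_zero.1 h1

end Holder

section Class

variable {n : ℕ} {M : Type*} [TopologicalSpace M] [T2Space M] [CompactSpace M]
  [ChartedSpace (EuclideanSpace ℝ (Fin n)) M] [IsManifold (𝓡 n) ∞ M]
  [MeasurableSpace M]

/-- The uniform `(R₀, q, C)`-`A_∞` condition: the reverse Hölder inequality with exponent `q` and
constant `C` for the weight `w` on all geodesic balls of radius at most `R₀`. -/
def UniformAInfty (g₀ : SmoothMetric n M) (R₀ q C : ℝ) (w : M → ℝ) : Prop :=
  ∀ (x : M) (r : ℝ), 0 < r → r ≤ R₀ →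
    (⨍ y in geodesicBall g₀ x r, w y ^ q ∂(riemVolume g₀)) ^ (1 / q) ≤
      C * ⨍ y in geodesicBall g₀ x r, w y ∂(riemVolume g₀)

/-- The set of smooth functions `f` with `vol(M, e^{2f} g₀) ≤ V` for which `e^{nf}` is
`(R₀, q, C)`-uniformly `A_∞` with respect to `g₀`. -/
def conformalClass (g₀ : SmoothMetric n M) (V R₀ q C : ℝ) :
    Set C^∞⟮𝓡 n, M; 𝓘(ℝ, ℝ), ℝ⟯ :=
  {f | riemVolume (conformal g₀ f) univ ≤ ENNReal.ofReal V ∧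
    UniformAInfty g₀ R₀ q C fun x => Real.exp (n * f x)}

end Class

end ConformalGeometry

end

/-! Put `β = 1 - 1/q`. Everything follows from one estimate, uniform over the class: `d_f ≤ K * d_0
^ β`.

The weight `w = e^{nf}` has `∫ w dμ_0 = vol(M, g_f) ≤ V`. Reverse Hölder on finitely many balls of
radius `R₀` covering `M` turns this into a bound for `∫ w^q dμ_0` (`exists_lintegral_weight_le`).
Hence `e^f` is bounded in `L^{nq}`. Since `e^f` is the length density of `g_f` relative to `g_0` and
`nq > n`, Morrey's inequality bounds `d_f` locally by a power of `d_0` with exponent `1 - n/(nq) =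
β` (`morrey`, `exists_nhds_riemEDist_conformal_le`). No derivative of `d_f` is needed: the argument
uses only the triangle inequality and the lengths of chart segments. Compactness and connectedness
of `M` make the bound global (`exists_forall_le_dist_rpow`).

By the triangle inequality the functions `d_f` are then bounded in `C^β(M × M)`, and such sets are
relatively compact in `C^α` for `α < β` by Arzelà–Ascoli and interpolation (`isCompact_holderBall`).
The same estimate says that the identity maps `(M, d_0) → (M, d_f)` are uniformly Hölder, so nets of
`(M, d_0)` are nets of every `(M, d_f)`, and Gromov's criterion applies
(`isCompact_closure_toGHSpace`). -/

noncomputable section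

namespace ConformalGeometry

/-! ### Morrey's inequality along segments in Euclidean space. -/

section Morrey

theorem setLIntegral_le_rpow_mul_measure {X : Type*} [MeasurableSpace X] (μ : Measure X)
    {h : X → ℝ≥0∞} (hh : Measurable h) (s : Set X) {p : ℝ} (hp : 1 < p) :
    ∫⁻ x in s, h x ∂μ ≤ (∫⁻ x in s, h x ^ p ∂μ) ^ (1 / p) * μ s ^ (1 - 1 / p) := by
  have hpq := Real.HolderConjugate.conjExponent hp
  have := ENNReal.lintegral_mul_le_Lp_mul_Lq (μ.restrict s) hpq hh.aemeasurable
    (aemeasurable_const (b := (1 : ℝ≥0∞)))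
  have e : 1 / p.conjExponent = 1 - 1 / p := by
    have := hpq.inv_add_inv_eq_one
    simp only [one_div]
    linarith
  simpa [e] using this

variable {E : Type*} [NormedAddCommGroup E] [NormedSpace ℝ E] [FiniteDimensional ℝ E]
  [MeasurableSpace E] [BorelSpace E] (μ : Measure E) [μ.IsAddHaarMeasure]

/-- Change of variables under the homothety of centre `y` and ratio `t`, whose Jacobian is `t ^ d`.
The indicator of the smaller ball reduces it to integrals over all of `E`, where translation and
scaling rules apply. -/
theorem setLIntegral_ball_homothety {h : E → ℝ≥0∞} (hh : Measurable h) (y : E) (r : ℝ) {t : ℝ}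
    (ht : 0 < t) :
    ∫⁻ z in Metric.ball y r, h (y + t • (z - y)) ∂μ =
      ENNReal.ofReal ((t ^ Module.finrank ℝ E)⁻¹) * ∫⁻ z in Metric.ball y (t * r), h z ∂μ := by
  set F : E → ℝ≥0∞ := (Metric.ball y (t * r)).indicator h with hF
  have hFm : Measurable F := hh.indicator Metric.isOpen_ball.measurableSet
  have e1 : ∫⁻ z in Metric.ball y r, h (y + t • (z - y)) ∂μ = ∫⁻ z, F (y + t • (z - y)) ∂μ := by
    rw [← lintegral_indicator Metric.isOpen_ball.measurableSet]
    congr 1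
    funext z
    have : y + t • (z - y) ∈ Metric.ball y (t * r) ↔ z ∈ Metric.ball y r := by
      rw [mem_ball_iff_norm, mem_ball_iff_norm, add_sub_cancel_left, norm_smul, Real.norm_eq_abs,
        abs_of_pos ht, mul_lt_mul_iff_right₀ ht]
    by_cases hz : z ∈ Metric.ball y r
    · rw [indicator_of_mem hz, hF, indicator_of_mem (this.2 hz)]
    · rw [indicator_of_notMem hz, hF, indicator_of_notMem (fun h' => hz (this.1 h'))]
  have hG : Measurable fun w => F (y + w) := hFm.comp (measurable_const_add y)
  rw [e1, lintegral_sub_right_eq_self (fun z => F (y + t • z)) y,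
    ← lintegral_map hG (measurable_const_smul t), Measure.map_addHaar_smul μ ht.ne',
    lintegral_smul_measure, lintegral_add_left_eq_self F y, hF,
    lintegral_indicator Metric.isOpen_ball.measurableSet, abs_of_pos (by positivity), smul_eq_mul]

theorem lintegral_Ioc_rpow_lt_top {b : ℝ} (hb : -1 < b) :
    ∫⁻ t in Ioc (0 : ℝ) 1, ENNReal.ofReal (t ^ b) < ⊤ := by
  have h := (intervalIntegral.intervalIntegrable_rpow' (a := 0) (b := 1) hb).1
  exact h.lintegral_lt_top

/-- The constant in `lintegral_ball_segment_le`. -/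
def segmentConst (q : ℝ) : ℝ≥0∞ :=
  μ (Metric.ball 0 1) ^ (1 - 1 / (Module.finrank ℝ E * q)) *
    ∫⁻ t in Ioc (0 : ℝ) 1, ENNReal.ofReal (t ^ (-(1 / q)))

variable [Nontrivial E]

omit [MeasurableSpace E] [BorelSpace E] in
theorem one_lt_finrank_mul {q : ℝ} (hq : 1 < q) : 1 < Module.finrank ℝ E * q := by
  have : (1 : ℝ) ≤ Module.finrank ℝ E := by exact_mod_cast Module.finrank_pos (R := ℝ) (M := E)
  nlinarith

omit [BorelSpace E] in
theorem segmentConst_lt_top {q : ℝ} (hq : 1 < q) : segmentConst μ q < ⊤ := by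
  refine ENNReal.mul_lt_top (ENNReal.rpow_lt_top_of_nonneg ?_ measure_ball_lt_top.ne)
    (lintegral_Ioc_rpow_lt_top ?_)
  · have := one_lt_finrank_mul (E := E) hq
    rw [sub_nonneg, div_le_one (by linarith)]
    exact this.le
  · have : 1 / q < 1 := (div_lt_one (by linarith)).2 hq
    linarith

/-- The integral over a ball of the integrals along the segments issued from its centre. -/
theorem lintegral_ball_segment_le {q : ℝ} (hq : 1 < q) {h : E → ℝ≥0∞} (hh : Measurable h) (y : E)
    {r : ℝ} (hr : 0 < r) :
    ∫⁻ z in Metric.ball y r, (∫⁻ t in Ioc (0 : ℝ) 1, h (y + t • (z - y))) ∂μ ≤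
      (∫⁻ z in Metric.ball y r, h z ^ (Module.finrank ℝ E * q) ∂μ) ^
          (1 / (Module.finrank ℝ E * q)) *
        segmentConst μ q * ENNReal.ofReal (r ^ (Module.finrank ℝ E - 1 / q)) := by
  set d := Module.finrank ℝ E with hd
  have hd1 : (1 : ℝ) ≤ d := by exact_mod_cast Module.finrank_pos (R := ℝ) (M := E)
  have hp : 1 < d * q := one_lt_finrank_mul hq
  set A := ∫⁻ z in Metric.ball y r, h z ^ (d * q) ∂μ with hA
  have hmeas : Measurable (Function.uncurry fun (z : E) (t : ℝ) => h (y + t • (z - y))) := by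
    apply hh.comp
    fun_prop
  -- Integrating in `z` first allows a homothety for each fixed `t`, and then Hölder with exponent
  -- `d * q` on the ball of radius `t * r`.
  rw [lintegral_lintegral_swap hmeas.aemeasurable]
  have key : ∀ t ∈ Ioc (0 : ℝ) 1, ∫⁻ z in Metric.ball y r, h (y + t • (z - y)) ∂μ ≤
      A ^ (1 / (d * q)) * μ (Metric.ball 0 1) ^ (1 - 1 / (d * q)) *
        ENNReal.ofReal (r ^ (d - 1 / q)) * ENNReal.ofReal (t ^ (-(1 / q))) := by
    intro t ht
    have ht0 := ht.1
    have hsub : Metric.ball y (t * r) ⊆ Metric.ball y r :=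
      Metric.ball_subset_ball (by nlinarith [ht.2])
    have hexp : 0 ≤ 1 - 1 / (d * q) := by
      rw [sub_nonneg, div_le_one (by linarith)]
      exact hp.le
    rw [setLIntegral_ball_homothety μ hh y r ht0]
    calc _ ≤ ENNReal.ofReal ((t ^ d)⁻¹) *
          (A ^ (1 / (d * q)) * μ (Metric.ball y (t * r)) ^ (1 - 1 / (d * q))) := by
          gcongr
          refine (setLIntegral_le_rpow_mul_measure μ hh _ hp).trans ?_
          gcongr
          exact lintegral_mono_set hsub
      _ = A ^ (1 / (d * q)) * μ (Metric.ball 0 1) ^ (1 - 1 / (d * q)) *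
          (ENNReal.ofReal ((t ^ d)⁻¹) * ENNReal.ofReal (((t * r) ^ d) ^ (1 - 1 / (d * q)))) := by
          rw [Measure.addHaar_ball μ y (by positivity), ENNReal.mul_rpow_of_nonneg _ _ hexp,
            ENNReal.ofReal_rpow_of_nonneg (by positivity) hexp]
          ring
      _ = _ := by
          rw [← ENNReal.ofReal_mul (by positivity), mul_assoc _ (ENNReal.ofReal _),
            ← ENNReal.ofReal_mul (by positivity)]
          congr 2
          have hq0 : q ≠ 0 := by linarith
          have hd0 : (d : ℝ) ≠ 0 := by linarith
          -- The Jacobian factor `t ^ (-d)` meets `t ^ (d - 1/q)` from the volume of the small ball.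
          -- What remains is `t ^ (-1/q)`, integrable at `0` because `q > 1`.
          have e1 : (d : ℝ) * (1 - 1 / (d * q)) = d - 1 / q := by field_simp
          rw [← Real.rpow_natCast (t * r) d, ← Real.rpow_mul (by positivity), e1,
            Real.mul_rpow ht0.le hr.le, ← Real.rpow_natCast t d, ← Real.rpow_neg ht0.le, ← mul_assoc,
            ← Real.rpow_add ht0, mul_comm]
          congr 2
          ring
  refine (setLIntegral_mono' measurableSet_Ioc key).trans_eq ?_
  rw [lintegral_const_mul _ (by fun_prop), segmentConst]
  ring

/-- **Morrey's inequality**, for a function `D` of two points which satisfies the triangle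
inequality and is bounded by the integrals of `h` along segments. -/
theorem morrey {q : ℝ} (hq : 1 < q) :
    ∃ K : ℝ≥0∞, K < ⊤ ∧ ∀ (h : E → ℝ≥0∞) (D : E → E → ℝ≥0∞) (a : E) (R : ℝ), Measurable h →
      (∀ y ∈ Metric.ball a R, ∀ y' ∈ Metric.ball a R, ∀ z ∈ Metric.ball a R,
        D y y' ≤ D y z + D y' z) →
      (∀ y ∈ Metric.ball a R, ∀ z ∈ Metric.ball a R,
        D y z ≤ ENNReal.ofReal ‖z - y‖ * ∫⁻ t in Ioc (0 : ℝ) 1, h (y + t • (z - y))) →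
      ∀ y ∈ Metric.ball a (R / 8), ∀ y' ∈ Metric.ball a (R / 8),
        D y y' ≤ K * (∫⁻ z in Metric.ball a R, h z ^ (Module.finrank ℝ E * q) ∂μ) ^
          (1 / (Module.finrank ℝ E * q)) * ENNReal.ofReal (dist y y' ^ (1 - 1 / q)) := by
  set d := Module.finrank ℝ E with hd
  have hB0 : μ (Metric.ball 0 1) ≠ 0 := (Metric.measure_ball_pos μ 0 one_pos).ne'
  have hBt : μ (Metric.ball 0 1) ≠ ⊤ := measure_ball_lt_top.ne
  -- The `2` counts the endpoints `y` and `y'`, the power of `2` comes from balls of radius `2 * r`,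
  -- and the inverse volume from averaging over the ball of radius `r`.
  refine ⟨(2 * segmentConst μ q * ENNReal.ofReal (2 ^ (d + 1 - 1 / q))) *
    (μ (Metric.ball 0 1))⁻¹, ?_, ?_⟩
  · refine ENNReal.mul_lt_top (ENNReal.mul_lt_top (ENNReal.mul_lt_top (by simp)
      (segmentConst_lt_top μ hq)) ENNReal.ofReal_lt_top) ?_
    simpa using pos_iff_ne_zero.2 hB0
  intro h D a R hh htri hseg y hy y' hy'
  have hR : 0 < R := by
    have := Metric.pos_of_mem_ball hy
    linarith
  have hyR : y ∈ Metric.ball a R := Metric.ball_subset_ball (by linarith) hy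
  have hyR' : y' ∈ Metric.ball a R := Metric.ball_subset_ball (by linarith) hy'
  rcases eq_or_ne y y' with rfl | hne
  · refine (hseg y hyR y hyR).trans ?_
    simp
  set r := dist y y' with hr_def
  have hr : 0 < r := dist_pos.2 hne
  -- The radius `R / 8` is small enough for this: the balls of radius `2 * r < R / 2` about `y` and
  -- `y'` stay inside `Metric.ball a R`.
  have hrR : r < R / 4 := by
    have h1 := dist_triangle_right y y' a
    rw [Metric.mem_ball] at hy hy'
    linarith
  set A := ∫⁻ z in Metric.ball a R, h z ^ (d * q) ∂μ with hA
  have hp : 1 < d * q := one_lt_finrank_mul hq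
  have hexp : 0 ≤ 1 / (d * q) := by positivity
  have hsub1 : Metric.ball y (2 * r) ⊆ Metric.ball a R := by
    refine Metric.ball_subset_ball' ?_
    rw [Metric.mem_ball] at hy
    linarith
  have hsub2 : Metric.ball y' (2 * r) ⊆ Metric.ball a R := by
    refine Metric.ball_subset_ball' ?_
    rw [Metric.mem_ball] at hy'
    linarith
  have hball : Metric.ball y r ⊆ Metric.ball y (2 * r) := Metric.ball_subset_ball (by linarith)
  have hball' : Metric.ball y r ⊆ Metric.ball y' (2 * r) := Metric.ball_subset_ball' (by linarith)
  have step : ∀ x ∈ Metric.ball a R, Metric.ball y r ⊆ Metric.ball x (2 * r) →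
      Metric.ball x (2 * r) ⊆ Metric.ball a R →
      ∫⁻ z in Metric.ball y r, ENNReal.ofReal ‖z - x‖ *
        (∫⁻ t in Ioc (0 : ℝ) 1, h (x + t • (z - x))) ∂μ ≤
      ENNReal.ofReal (2 * r) * (A ^ (1 / (d * q)) * segmentConst μ q *
        ENNReal.ofReal ((2 * r) ^ (d - 1 / q))) := by
    intro x _ h1 h2
    calc _ ≤ ∫⁻ z in Metric.ball x (2 * r), ENNReal.ofReal (2 * r) *
        (∫⁻ t in Ioc (0 : ℝ) 1, h (x + t • (z - x))) ∂μ := by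
          refine (lintegral_mono_set h1).trans
            (setLIntegral_mono' Metric.isOpen_ball.measurableSet fun z hz => ?_)
          gcongr
          exact (mem_ball_iff_norm.1 hz).le
      _ = ENNReal.ofReal (2 * r) * ∫⁻ z in Metric.ball x (2 * r),
        (∫⁻ t in Ioc (0 : ℝ) 1, h (x + t • (z - x))) ∂μ :=
          lintegral_const_mul' _ _ ENNReal.ofReal_ne_top
      _ ≤ _ := by
          gcongr
          refine (lintegral_ball_segment_le μ hq hh x (by positivity)).trans ?_
          gcongr
          exact lintegral_mono_set h2
  have hmeas : Measurable fun z => ENNReal.ofReal ‖z - y‖ *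
      ∫⁻ t in Ioc (0 : ℝ) 1, h (y + t • (z - y)) := by
    refine Measurable.mul (by fun_prop) (Measurable.lintegral_prod_right ?_)
    apply hh.comp
    fun_prop
  -- Average `D y y' ≤ D y z + D y' z` over `z` in the ball of radius `r` about `y`, which lies in
  -- the balls of radius `2 * r` about both points.
  have total : D y y' * μ (Metric.ball y r) ≤ 2 * (ENNReal.ofReal (2 * r) *
      (A ^ (1 / (d * q)) * segmentConst μ q * ENNReal.ofReal ((2 * r) ^ (d - 1 / q)))) := by
    rw [← setLIntegral_const, two_mul (ENNReal.ofReal _ * _)]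
    refine le_trans ?_ (add_le_add (step y hyR hball hsub1) (step y' hyR' hball' hsub2))
    rw [← lintegral_add_left hmeas]
    refine setLIntegral_mono' Metric.isOpen_ball.measurableSet fun z hz => ?_
    have hzR := hsub1 (hball hz)
    exact (htri y hyR y' hyR' z hzR).trans
      (add_le_add (hseg y hyR z hzR) (hseg y' hyR' z hzR))
  rw [Measure.addHaar_ball μ y hr.le] at total
  -- Isolates the factor `r ^ d`, which cancels against the volume of the ball and leaves the Hölder
  -- power `r ^ (1 - 1/q)`.
  have e : ENNReal.ofReal (2 * r) * ENNReal.ofReal ((2 * r) ^ (d - 1 / q)) =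
      ENNReal.ofReal (2 ^ (d + 1 - 1 / q)) * ENNReal.ofReal (r ^ (1 - 1 / q)) *
        ENNReal.ofReal (r ^ d) := by
    rw [← ENNReal.ofReal_mul (by positivity), ← ENNReal.ofReal_mul (by positivity),
      ← ENNReal.ofReal_mul (by positivity)]
    congr 1
    rw [← Real.rpow_one_add' (by positivity), mul_assoc, ← Real.rpow_natCast r d,
      ← Real.rpow_add hr, Real.mul_rpow (by norm_num) hr.le]
    · congr 2 <;> ring
    · have : (1 : ℝ) ≤ d := by exact_mod_cast Module.finrank_pos (R := ℝ) (M := E)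
      have : 1 / q < 1 := (div_lt_one (by linarith)).2 hq
      linarith
  have hrd0 : ENNReal.ofReal (r ^ d) ≠ 0 := by
    simpa using pow_pos hr d
  have total2 : D y y' * μ (Metric.ball 0 1) ≤ 2 * segmentConst μ q *
      ENNReal.ofReal (2 ^ (d + 1 - 1 / q)) * A ^ (1 / (d * q)) *
        ENNReal.ofReal (r ^ (1 - 1 / q)) := by
    refine (ENNReal.mul_le_mul_iff_left hrd0 ENNReal.ofReal_ne_top).1 ?_
    calc _ = D y y' * (ENNReal.ofReal (r ^ d) * μ (Metric.ball 0 1)) := by ring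
      _ ≤ _ := total
      _ = 2 * (A ^ (1 / (d * q)) * segmentConst μ q) *
        (ENNReal.ofReal (2 * r) * ENNReal.ofReal ((2 * r) ^ (d - 1 / q))) := by ring
      _ = _ := by
        rw [e]
        ring
  calc D y y' = D y y' * μ (Metric.ball 0 1) * (μ (Metric.ball 0 1))⁻¹ := by
        rw [mul_assoc, ENNReal.mul_inv_cancel hB0 hBt, mul_one]
    _ ≤ 2 * segmentConst μ q * ENNReal.ofReal (2 ^ (d + 1 - 1 / q)) * A ^ (1 / (d * q)) *
        ENNReal.ofReal (r ^ (1 - 1 / q)) * (μ (Metric.ball 0 1))⁻¹ := by gcongr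
    _ = _ := by ring

end Morrey

/-! ### The metric in charts: continuity, comparison with the Euclidean metric, determinant. -/

section Gram

variable {n : ℕ} {M : Type*} [TopologicalSpace M]
  [ChartedSpace (EuclideanSpace ℝ (Fin n)) M] [IsManifold (𝓡 n) ∞ M]

/-- The metric read in the chart at `c`: the inner product at `z` of the coordinate vectors `v` and
`w`. -/
def gramForm (g : SmoothMetric n M) (c : M) (z v w : EuclideanSpace ℝ (Fin n)) : ℝ :=
  g.inner ((chartAt (EuclideanSpace ℝ (Fin n)) c).symm z)
    (mfderiv (𝓡 n) (𝓡 n) (chartAt (EuclideanSpace ℝ (Fin n)) c).symm z v)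
    (mfderiv (𝓡 n) (𝓡 n) (chartAt (EuclideanSpace ℝ (Fin n)) c).symm z w)

theorem gramMatrix_apply (g : SmoothMetric n M) (c : M) (z : EuclideanSpace ℝ (Fin n))
    (i j : Fin n) : gramMatrix g c z i j =
      gramForm g c z (EuclideanSpace.single i 1) (EuclideanSpace.single j 1) := rfl

theorem gramForm_conformal (g : SmoothMetric n M) (f : C^∞⟮𝓡 n, M; 𝓘(ℝ, ℝ), ℝ⟯) (c : M)
    (z v w : EuclideanSpace ℝ (Fin n)) : gramForm (conformal g f) c z v w =
      Real.exp (2 * f ((chartAt (EuclideanSpace ℝ (Fin n)) c).symm z)) * gramForm g c z v w := rfl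

omit [IsManifold (𝓡 n) ∞ M] in
theorem continuousOn_mfderiv_chart_symm [IsManifold (𝓡 n) 1 M] (c : M) :
    ContinuousOn (fun m : EuclideanSpace ℝ (Fin n) × EuclideanSpace ℝ (Fin n) =>
      (⟨(chartAt (EuclideanSpace ℝ (Fin n)) c).symm m.1,
        mfderiv (𝓡 n) (𝓡 n) (chartAt (EuclideanSpace ℝ (Fin n)) c).symm m.1 m.2⟩ :
        TangentBundle (𝓡 n) M))
      ((chartAt (EuclideanSpace ℝ (Fin n)) c).target ×ˢ univ) := by
  set φ := chartAt (EuclideanSpace ℝ (Fin n)) c with hφ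
  have h : ContMDiffOn (𝓡 n) (𝓡 n) 1 φ.symm φ.target := contMDiffOn_chart_symm
  have h2 := h.continuousOn_tangentMapWithin le_rfl φ.open_target.uniqueMDiffOn
  have h3 : Continuous (tangentBundleModelSpaceHomeomorph (𝓡 n)).symm :=
    (tangentBundleModelSpaceHomeomorph (𝓡 n)).symm.continuous
  have h4 := h2.comp (h3.continuousOn (s := φ.target ×ˢ univ)) (by
    rintro ⟨z, w⟩ ⟨hz, -⟩
    exact hz)
  refine h4.congr ?_
  rintro ⟨z, w⟩ ⟨hz, -⟩
  have e : mfderivWithin (𝓡 n) (𝓡 n) φ.symm φ.target z = mfderiv (𝓡 n) (𝓡 n) φ.symm z :=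
    mfderivWithin_of_isOpen φ.open_target hz
  change _ = (⟨φ.symm z, mfderivWithin (𝓡 n) (𝓡 n) φ.symm φ.target z w⟩ : TangentBundle (𝓡 n) M)
  rw [e]

theorem continuousOn_gramForm (g : SmoothMetric n M) (c : M) :
    ContinuousOn (fun m : EuclideanSpace ℝ (Fin n) × EuclideanSpace ℝ (Fin n) ×
      EuclideanSpace ℝ (Fin n) => gramForm g c m.1 m.2.1 m.2.2)
      ((chartAt (EuclideanSpace ℝ (Fin n)) c).target ×ˢ univ) := by
  let : RiemannianBundle (fun x : M => TangentSpace (𝓡 n) x) := ⟨g.toRiemannianMetric⟩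
  have : IsContinuousRiemannianBundle (EuclideanSpace ℝ (Fin n))
      (fun x : M => TangentSpace (𝓡 n) x) :=
    ⟨g.inner, g.contMDiff.continuous, fun _ _ _ => rfl⟩
  have : IsManifold (𝓡 n) 1 M := IsManifold.of_le (n := ∞) (by norm_cast)
  have h := continuousOn_mfderiv_chart_symm (n := n) c
  refine ContinuousOn.inner_bundle (F := EuclideanSpace ℝ (Fin n))
    (E := fun x : M => TangentSpace (𝓡 n) x)
    (b := fun m : EuclideanSpace ℝ (Fin n) × EuclideanSpace ℝ (Fin n) ×
      EuclideanSpace ℝ (Fin n) => (chartAt (EuclideanSpace ℝ (Fin n)) c).symm m.1) ?_ ?_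
  · exact h.comp (f := fun m : EuclideanSpace ℝ (Fin n) × EuclideanSpace ℝ (Fin n) ×
      EuclideanSpace ℝ (Fin n) => (m.1, m.2.1)) (by fun_prop) (fun m hm => ⟨hm.1, trivial⟩)
  · exact h.comp (f := fun m : EuclideanSpace ℝ (Fin n) × EuclideanSpace ℝ (Fin n) ×
      EuclideanSpace ℝ (Fin n) => (m.1, m.2.2)) (by fun_prop) (fun m hm => ⟨hm.1, trivial⟩)

/-- `gramForm` as a bilinear map. -/
def gramBilin (g : SmoothMetric n M) (c : M) (z : EuclideanSpace ℝ (Fin n)) :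
    EuclideanSpace ℝ (Fin n) →ₗ[ℝ] EuclideanSpace ℝ (Fin n) →ₗ[ℝ] ℝ :=
  let D : EuclideanSpace ℝ (Fin n) →ₗ[ℝ] TangentSpace (𝓡 n)
      ((chartAt (EuclideanSpace ℝ (Fin n)) c).symm z) :=
    (mfderiv (𝓡 n) (𝓡 n) (chartAt (EuclideanSpace ℝ (Fin n)) c).symm z).toLinearMap
  LinearMap.mk₂ ℝ (fun v w => g.inner _ (D v) (D w)) (fun _ _ _ => by simp) (fun _ _ _ => by simp)
    (fun _ _ _ => by simp) (fun _ _ _ => by simp)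

theorem gramForm_eq (g : SmoothMetric n M) (c : M) (z v w : EuclideanSpace ℝ (Fin n)) :
    gramForm g c z v w = gramBilin g c z v w := rfl

theorem gramForm_smul (g : SmoothMetric n M) (c : M) (z w : EuclideanSpace ℝ (Fin n)) (t : ℝ) :
    gramForm g c z (t • w) (t • w) = t ^ 2 * gramForm g c z w w := by
  simp only [gramForm_eq, map_smul, LinearMap.smul_apply, smul_eq_mul]
  ring

omit [IsManifold (𝓡 n) ∞ M] in
theorem mfderiv_chart_symm_injective [IsManifold (𝓡 n) 1 M] {c : M}
    {z : EuclideanSpace ℝ (Fin n)} (hz : z ∈ (chartAt (EuclideanSpace ℝ (Fin n)) c).target) :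
    Function.Injective
      (mfderiv (𝓡 n) (𝓡 n) (chartAt (EuclideanSpace ℝ (Fin n)) c).symm z) := by
  set φ := chartAt (EuclideanSpace ℝ (Fin n)) c with hφ
  have h : φ.MDifferentiable (𝓡 n) (𝓡 n) := mdifferentiable_chart c
  exact h.symm.mfderiv_injective hz

theorem gramForm_self_pos (g : SmoothMetric n M) {c : M} {z w : EuclideanSpace ℝ (Fin n)}
    (hz : z ∈ (chartAt (EuclideanSpace ℝ (Fin n)) c).target) (hw : w ≠ 0) :
    0 < gramForm g c z w w := by
  have : IsManifold (𝓡 n) 1 M := IsManifold.of_le (n := ∞) (by norm_cast)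
  refine g.pos _ _ fun h => hw ?_
  exact mfderiv_chart_symm_injective hz (h.trans (map_zero _).symm)

/-- Near every point, the metric read in a chart is comparable with the Euclidean one. -/
theorem eventually_gramForm_bounds (g : SmoothMetric n M) {c : M}
    {z₀ : EuclideanSpace ℝ (Fin n)} (hz : z₀ ∈ (chartAt (EuclideanSpace ℝ (Fin n)) c).target) :
    ∃ C : ℝ≥0, 0 < C ∧ ∀ᶠ z in 𝓝 z₀, ∀ w, gramForm g c z w w ≤ (C * ‖w‖) ^ 2 ∧
      ‖w‖ ^ 2 ≤ C ^ 2 * gramForm g c z w w := by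
  set S := Metric.sphere (0 : EuclideanSpace ℝ (Fin n)) 1
  have hS : IsCompact S := isCompact_sphere _ _
  have hcont : ∀ w : EuclideanSpace ℝ (Fin n), ContinuousAt
      (fun m : EuclideanSpace ℝ (Fin n) × EuclideanSpace ℝ (Fin n) =>
        gramForm g c m.1 m.2 m.2) (z₀, w) := by
    intro w
    have h1 : ContinuousAt (fun m : EuclideanSpace ℝ (Fin n) × EuclideanSpace ℝ (Fin n) ×
      EuclideanSpace ℝ (Fin n) => gramForm g c m.1 m.2.1 m.2.2) (z₀, w, w) :=
      (continuousOn_gramForm g c).continuousAt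
        (prod_mem_nhds ((chartAt _ c).open_target.mem_nhds hz) univ_mem)
    exact ContinuousAt.comp (f := fun m : EuclideanSpace ℝ (Fin n) × EuclideanSpace ℝ (Fin n) =>
      (m.1, m.2, m.2)) (x := (z₀, w)) h1 (by fun_prop)
  obtain ⟨C, hC0, hC1, hC⟩ : ∃ C : ℝ, 0 < C ∧ 1 ≤ C ∧ ∀ w ∈ S, gramForm g c z₀ w w < C ∧
      C⁻¹ < gramForm g c z₀ w w := by
    have hc1 : Continuous fun w => gramForm g c z₀ w w := by
      rw [continuous_iff_continuousAt]
      exact fun w => (hcont w).comp (f := fun w => (z₀, w)) (by fun_prop)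
    have hpos : ∀ w ∈ S, 0 < gramForm g c z₀ w w := fun w hw =>
      gramForm_self_pos g hz (ne_zero_of_mem_unit_sphere ⟨w, hw⟩)
    obtain ⟨A, hA⟩ := (hS.bddAbove_image hc1.continuousOn)
    obtain ⟨B, hB⟩ := (hS.bddAbove_image
      (hc1.continuousOn.inv₀ fun w hw => (hpos w hw).ne'))
    -- Taking `C ≥ 1` lets the bounds `C` and `C⁻¹` on the sphere be weakened to `C ^ 2` and `C ^
    -- (-2)`, the form stated.
    refine ⟨max 1 (max (A + 1) (B + 1)), by positivity, le_max_left _ _, fun w hw => ⟨?_, ?_⟩⟩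
    · have := hA (mem_image_of_mem _ hw)
      exact (lt_of_le_of_lt this (lt_add_one A)).trans_le
        ((le_max_left _ _).trans (le_max_right _ _))
    · have := hB (mem_image_of_mem _ hw)
      have h2 := (lt_of_le_of_lt this (lt_add_one B)).trans_le
        ((le_max_right (A + 1) _).trans (le_max_right 1 _))
      exact inv_lt_of_inv_lt₀ (hpos w hw) h2
  -- Strict inequalities at `z₀` persist nearby, uniformly on the sphere by its compactness;
  -- homogeneity then handles all `w`.
  have hev : ∀ᶠ z in 𝓝 z₀, ∀ w ∈ S, gramForm g c z w w < C ∧ C⁻¹ < gramForm g c z w w := by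
    refine hS.eventually_forall_of_forall_eventually fun w hw => ?_
    exact ((hcont w).eventually_lt_const (hC w hw).1).and
      ((hcont w).eventually_const_lt (hC w hw).2)
  refine ⟨⟨C, hC0.le⟩, hC0, hev.mono fun z hz w => ?_⟩
  change _ ≤ (C * ‖w‖) ^ 2 ∧ _ ≤ C ^ 2 * _
  rcases eq_or_ne w 0 with rfl | hw
  · simp [gramForm_eq]
  have hw' : 0 < ‖w‖ := norm_pos_iff.2 hw
  have h1 := hz (‖w‖⁻¹ • w) (by simp [S, norm_smul, hw'.ne'])
  have h2 : gramForm g c z w w = ‖w‖ ^ 2 * gramForm g c z (‖w‖⁻¹ • w) (‖w‖⁻¹ • w) := by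
    rw [← gramForm_smul, smul_smul, mul_inv_cancel₀ hw'.ne', one_smul]
  set G := gramForm g c z (‖w‖⁻¹ • w) (‖w‖⁻¹ • w)
  have h3 : 1 ≤ C * G := by
    have := mul_lt_mul_of_pos_left h1.2 hC0
    rw [mul_inv_cancel₀ hC0.ne'] at this
    exact this.le
  rw [h2]
  constructor
  · nlinarith [sq_nonneg ‖w‖, mul_le_mul_of_nonneg_left h1.1.le (sq_nonneg ‖w‖),
      mul_le_mul_of_nonneg_left hC1 (mul_nonneg hC0.le (sq_nonneg ‖w‖))]
  · have : 1 ≤ C ^ 2 * G := by nlinarith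
    nlinarith [mul_le_mul_of_nonneg_left this (sq_nonneg ‖w‖)]

theorem gramMatrix_posDef (g : SmoothMetric n M) {c : M} {z : EuclideanSpace ℝ (Fin n)}
    (hz : z ∈ (chartAt (EuclideanSpace ℝ (Fin n)) c).target) : (gramMatrix g c z).PosDef := by
  refine Matrix.PosDef.of_dotProduct_mulVec_pos ?_ fun x hx => ?_
  · ext i j
    simp only [Matrix.conjTranspose_apply, gramMatrix_apply, star_trivial]
    exact g.symm _ _ _
  · have hw : WithLp.toLp 2 x ≠ (0 : EuclideanSpace ℝ (Fin n)) := by simpa using hx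
    have h := gramForm_self_pos g hz hw
    have e : (WithLp.toLp 2 x : EuclideanSpace ℝ (Fin n)) =
        ∑ i, x i • EuclideanSpace.single i (1 : ℝ) := by
      ext j
      simp [Finset.sum_apply, Pi.single_apply]
    refine h.trans_eq ?_
    rw [e]
    simp only [gramForm_eq, map_sum, map_smul, LinearMap.sum_apply, LinearMap.smul_apply,
      dotProduct, Matrix.mulVec, gramMatrix_apply, star_trivial, Finset.mul_sum, smul_eq_mul]
    refine Finset.sum_congr rfl fun i _ => Finset.sum_congr rfl fun j _ => ?_
    have hs : gramBilin g c z (EuclideanSpace.single j 1) (EuclideanSpace.single i 1) =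
        gramBilin g c z (EuclideanSpace.single i 1) (EuclideanSpace.single j 1) := g.symm _ _ _
    rw [hs]
    ring

theorem continuousOn_gramMatrix_det (g : SmoothMetric n M) (c : M) :
    ContinuousOn (fun z => (gramMatrix g c z).det)
      (chartAt (EuclideanSpace ℝ (Fin n)) c).target := by
  have h : ContinuousOn (fun z => gramMatrix g c z)
      (chartAt (EuclideanSpace ℝ (Fin n)) c).target := by
    refine continuousOn_pi.2 fun i => continuousOn_pi.2 fun j => ?_
    simp only [gramMatrix_apply]
    exact (continuousOn_gramForm g c).comp (f := fun z => (z, EuclideanSpace.single i (1 : ℝ),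
      EuclideanSpace.single j (1 : ℝ))) (by fun_prop) fun z hz => ⟨hz, trivial⟩
  exact (Continuous.matrix_det continuous_id).comp_continuousOn h

/-- Scaling an `n × n` matrix by `e^{2f}` scales its determinant by `e^{2nf}`; the square root is
the weight `e^{nf}`. -/
theorem gramMatrix_conformal_det (g : SmoothMetric n M) (f : C^∞⟮𝓡 n, M; 𝓘(ℝ, ℝ), ℝ⟯) (c : M)
    (z : EuclideanSpace ℝ (Fin n)) : √(gramMatrix (conformal g f) c z).det =
      Real.exp (n * f ((chartAt (EuclideanSpace ℝ (Fin n)) c).symm z)) *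
        √(gramMatrix g c z).det := by
  have e : gramMatrix (conformal g f) c z =
      Real.exp (2 * f ((chartAt (EuclideanSpace ℝ (Fin n)) c).symm z)) • gramMatrix g c z := by
    ext i j
    rfl
  rw [e, Matrix.det_smul, Fintype.card_fin, ← Real.exp_nat_mul, Real.sqrt_mul (Real.exp_pos _).le]
  congr 1
  rw [Real.sqrt_eq_iff_mul_self_eq (Real.exp_pos _).le (Real.exp_pos _).le, ← Real.exp_add]
  congr 1
  ring

end Gram

/-! ### Lengths of curves in charts, and local comparison of distances. -/

section Paths

variable {n : ℕ} {M : Type*} [TopologicalSpace M]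
  [ChartedSpace (EuclideanSpace ℝ (Fin n)) M] [IsManifold (𝓡 n) ∞ M]

theorem enorm_tangentSpace (g : SmoothMetric n M) (x : M) (v : TangentSpace (𝓡 n) x) :
    letI : RiemannianBundle (fun x : M => TangentSpace (𝓡 n) x) := ⟨g.toRiemannianMetric⟩
    ‖v‖ₑ = ENNReal.ofReal √(g.inner x v v) := by
  let : RiemannianBundle (fun x : M => TangentSpace (𝓡 n) x) := ⟨g.toRiemannianMetric⟩
  change ‖v‖ₑ = ENNReal.ofReal √(inner ℝ v v)
  rw [← norm_eq_sqrt_real_inner, ofReal_norm]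

/-- The distance is at most the length of the curve which is a segment in the chart at `c`. -/
theorem riemEDist_le_lintegral_segment (g : SmoothMetric n M) (c : M)
    {y z : EuclideanSpace ℝ (Fin n)}
    (h : segment ℝ y z ⊆ (chartAt (EuclideanSpace ℝ (Fin n)) c).target) :
    riemEDist g ((chartAt (EuclideanSpace ℝ (Fin n)) c).symm y)
      ((chartAt (EuclideanSpace ℝ (Fin n)) c).symm z) ≤
    ∫⁻ t in Ioc (0 : ℝ) 1,
      ENNReal.ofReal √(gramForm g c (y + t • (z - y)) (z - y) (z - y)) := by
  let : RiemannianBundle (fun x : M => TangentSpace (𝓡 n) x) := ⟨g.toRiemannianMetric⟩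
  have : IsManifold (𝓡 n) 1 M := IsManifold.of_le (n := ∞) (by norm_cast)
  set φ := chartAt (EuclideanSpace ℝ (Fin n)) c with hφ
  let η : ℝ → EuclideanSpace ℝ (Fin n) := fun t => y + t • (z - y)
  have hη : ∀ t ∈ Icc (0 : ℝ) 1, η t ∈ φ.target := fun t ht => h <| by
    rw [segment_eq_image']
    exact mem_image_of_mem _ ht
  have hηs : ContMDiff 𝓘(ℝ, ℝ) (𝓡 n) 1 η := by
    rw [contMDiff_iff_contDiff]
    fun_prop
  have hs : ContMDiffOn (𝓡 n) (𝓡 n) 1 φ.symm φ.target := contMDiffOn_chart_symm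
  have hle : riemannianEDist (𝓡 n) (φ.symm y) (φ.symm z) ≤
      pathELength (𝓡 n) (φ.symm ∘ η) 0 1 :=
    riemannianEDist_le_pathELength (hs.comp hηs.contMDiffOn hη) (by simp [η]) (by simp [η])
      zero_le_one
  refine hle.trans ?_
  rw [pathELength_eq_lintegral_mfderiv_Ioo]
  refine (setLIntegral_mono' measurableSet_Ioo fun t ht => ?_).trans
    (lintegral_mono_set Ioo_subset_Ioc_self)
  have ht' := hη t (Ioo_subset_Icc_self ht)
  have e1 : mfderiv 𝓘(ℝ, ℝ) (𝓡 n) (φ.symm ∘ η) t =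
      (mfderiv (𝓡 n) (𝓡 n) φ.symm (η t)).comp (mfderiv 𝓘(ℝ, ℝ) (𝓡 n) η t) :=
    mfderiv_comp t ((hs.contMDiffAt (φ.open_target.mem_nhds ht')).mdifferentiableAt one_ne_zero)
      (hηs.mdifferentiable one_ne_zero t)
  have e2 : mfderiv 𝓘(ℝ, ℝ) (𝓡 n) η t (1 : ℝ) = z - y := by
    rw [mfderiv_eq_fderiv]
    have : HasDerivAt η (z - y) t := by
      have h1 := ((hasDerivAt_id t).smul_const (z - y)).const_add y
      rw [one_smul] at h1
      exact h1
    rw [this.hasFDerivAt.fderiv]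
    exact one_smul ℝ (z - y)
  have e3 : mfderiv 𝓘(ℝ, ℝ) (𝓡 n) (φ.symm ∘ η) t (1 : ℝ) =
      mfderiv (𝓡 n) (𝓡 n) φ.symm (η t) (z - y) := by
    rw [e1, ← e2]
    rfl
  exact le_of_eq ((congrArg (fun v : TangentSpace (𝓡 n) (φ.symm (η t)) => ‖v‖ₑ) e3).trans
    (enorm_tangentSpace g _ _))

theorem gramForm_mfderiv_chart (g : SmoothMetric n M) {c x : M}
    (hx : x ∈ (chartAt (EuclideanSpace ℝ (Fin n)) c).source) (v : TangentSpace (𝓡 n) x) :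
    gramForm g c (chartAt (EuclideanSpace ℝ (Fin n)) c x)
      (mfderiv (𝓡 n) (𝓡 n) (chartAt (EuclideanSpace ℝ (Fin n)) c) x v)
      (mfderiv (𝓡 n) (𝓡 n) (chartAt (EuclideanSpace ℝ (Fin n)) c) x v) = g.inner x v v := by
  have : IsManifold (𝓡 n) 1 M := IsManifold.of_le (n := ∞) (by norm_cast)
  set φ := chartAt (EuclideanSpace ℝ (Fin n)) c with hφ
  have hd : φ.MDifferentiable (𝓡 n) (𝓡 n) := mdifferentiable_chart c
  -- The base points `φ.symm (φ x)` and `x` agree only propositionally, so the tangent vectors have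
  -- different types. Taking `u` in the model space allows substitution of both equalities.
  have key : ∀ x', x' = x → ∀ u : EuclideanSpace ℝ (Fin n), u = v →
      g.inner x' u u = g.inner x v v := by
    rintro x' rfl u rfl
    rfl
  refine key _ (φ.left_inv hx) _ ?_
  have := hd.symm_comp_deriv hx
  exact congrArg (fun L : TangentSpace (𝓡 n) x →L[ℝ] TangentSpace (𝓡 n) x => L v) this

variable [T2Space M] [CompactSpace M]

theorem riemEDist_triangle (g : SmoothMetric n M) (x y z : M) :
    riemEDist g x z ≤ riemEDist g x y + riemEDist g y z := by
  let := riemEMetricSpace g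
  exact edist_triangle x y z

theorem riemEDist_comm (g : SmoothMetric n M) (x y : M) : riemEDist g x y = riemEDist g y x := by
  let := riemEMetricSpace g
  exact edist_comm x y

theorem riemEDist_self (g : SmoothMetric n M) (x : M) : riemEDist g x x = 0 := by
  let := riemEMetricSpace g
  exact edist_self x

/-- Charts are locally Lipschitz for the Riemannian distance. -/
theorem exists_edist_chart_le (g : SmoothMetric n M) {c p : M}
    (hp : p ∈ (chartAt (EuclideanSpace ℝ (Fin n)) c).source) :
    ∃ C : ℝ≥0, ∃ U ∈ 𝓝 p, ∀ x ∈ U, ∀ y ∈ U,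
      edist (chartAt (EuclideanSpace ℝ (Fin n)) c x) (chartAt (EuclideanSpace ℝ (Fin n)) c y) ≤
        C * riemEDist g x y := by
  set φ := chartAt (EuclideanSpace ℝ (Fin n)) c with hφ
  obtain ⟨C, hC0, hC⟩ := eventually_gramForm_bounds g (φ.map_source hp)
  have hN : {x | x ∈ φ.source ∧ ∀ w, ‖w‖ ^ 2 ≤ C ^ 2 * gramForm g c (φ x) w w} ∈ 𝓝 p := by
    filter_upwards [φ.open_source.mem_nhds hp, (φ.continuousAt hp).eventually hC] with x hx hx2
    exact ⟨hx, fun w => (hx2 w).2⟩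
  obtain ⟨s, hs0, hs⟩ : ∃ s > 0, ∀ x, riemEDist g p x < s + s + s →
      x ∈ φ.source ∧ ∀ w, ‖w‖ ^ 2 ≤ C ^ 2 * gramForm g c (φ x) w w := by
    let := riemEMetricSpace g
    obtain ⟨ε, hε, h⟩ := EMetric.mem_nhds_iff.1 hN
    -- One third for the distance from `p` to `x`, two for a curve from `x` of length below `s + s`:
    -- such a curve never leaves the region where the comparison holds.
    refine ⟨ε / 3, ENNReal.div_pos hε.ne' (by simp), fun x hx => h ?_⟩
    rw [ENNReal.add_thirds] at hx
    rw [Metric.mem_eball']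
    exact hx
  refine ⟨C, {x | riemEDist g p x < s}, ?_, fun x hx y hy => ?_⟩
  · let := riemEMetricSpace g
    have : Metric.eball p s ∈ 𝓝 p := Metric.eball_mem_nhds p hs0
    filter_upwards [this] with x hx
    exact Metric.mem_eball'.1 hx
  have hxy : riemEDist g x y < s + s := by
    refine (riemEDist_triangle g x p y).trans_lt ?_
    rw [riemEDist_comm g x p]
    exact ENNReal.add_lt_add hx hy
  let : RiemannianBundle (fun x : M => TangentSpace (𝓡 n) x) := ⟨g.toRiemannianMetric⟩
  have : IsManifold (𝓡 n) 1 M := IsManifold.of_le (n := ∞) (by norm_cast)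
  -- The infimum of lengths need not be attained, so the bound is proved for each `r` slightly above
  -- it, and `r` then decreases to the distance.
  have main : ∀ r : ℝ≥0∞, riemEDist g x y < r → r ≤ s + s →
      edist (φ x) (φ y) ≤ C * r := by
    intro r hr hrs
    obtain ⟨γ, hγ0, hγ1, hγs, hγl, -, -⟩ :=
      exists_lt_locally_constant_of_riemannianEDist_lt (I := 𝓡 n) (x := x) (y := y) hr zero_lt_one
    have hγN : ∀ t ∈ Icc (0 : ℝ) 1, γ t ∈ φ.source ∧
        ∀ w, ‖w‖ ^ 2 ≤ C ^ 2 * gramForm g c (φ (γ t)) w w := by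
      intro t ht
      refine hs _ ((riemEDist_triangle g p x _).trans_lt ?_)
      rw [add_assoc]
      refine ENNReal.add_lt_add hx (lt_of_le_of_lt ?_ (hγl.trans_le hrs))
      calc riemannianEDist (𝓡 n) x (γ t) ≤ pathELength (𝓡 n) γ 0 t :=
            riemannianEDist_le_pathELength hγs.contMDiffOn hγ0 rfl ht.1
        _ ≤ _ := pathELength_mono le_rfl ht.2
    have hφs : ContMDiffOn (𝓡 n) (𝓡 n) 1 φ φ.source := contMDiffOn_chart
    have hcomp : ContMDiffOn 𝓘(ℝ, ℝ) (𝓡 n) 1 (φ ∘ γ) (Icc 0 1) :=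
      hφs.comp hγs.contMDiffOn fun t ht => (hγN t ht).1
    have h1 := enorm_sub_le_lintegral_derivWithin_Icc_of_contDiffOn_Icc
      (contMDiffOn_iff_contDiffOn.1 hcomp) zero_le_one
    rw [edist_comm, edist_eq_enorm_sub, ← hγ0, ← hγ1]
    refine h1.trans ?_
    calc ∫⁻ t in Icc (0 : ℝ) 1, ‖derivWithin (φ ∘ γ) (Icc 0 1) t‖ₑ
        = ∫⁻ t in Ioo (0 : ℝ) 1, ‖derivWithin (φ ∘ γ) (Icc 0 1) t‖ₑ := by
          rw [restrict_Ioo_eq_restrict_Icc]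
      _ ≤ ∫⁻ t in Ioo (0 : ℝ) 1, C * ‖mfderiv 𝓘(ℝ, ℝ) (𝓡 n) γ t (1 : ℝ)‖ₑ := by
          refine setLIntegral_mono' measurableSet_Ioo fun t ht => ?_
          have ht' := hγN t (Ioo_subset_Icc_self ht)
          have hγt : MDifferentiableAt 𝓘(ℝ, ℝ) (𝓡 n) γ t := hγs.mdifferentiable one_ne_zero t
          have hd : φ.MDifferentiable (𝓡 n) (𝓡 n) := mdifferentiable_chart c
          have e1 : mfderiv 𝓘(ℝ, ℝ) (𝓡 n) (φ ∘ γ) t =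
              (mfderiv (𝓡 n) (𝓡 n) φ (γ t)).comp (mfderiv 𝓘(ℝ, ℝ) (𝓡 n) γ t) :=
            mfderiv_comp t (hd.mdifferentiableAt ht'.1) hγt
          set v := mfderiv 𝓘(ℝ, ℝ) (𝓡 n) γ t (1 : ℝ) with hv
          set w : EuclideanSpace ℝ (Fin n) := mfderiv (𝓡 n) (𝓡 n) φ (γ t) v with hw
          have e2 : derivWithin (φ ∘ γ) (Icc 0 1) t = w := by
            rw [derivWithin_of_mem_nhds (Icc_mem_nhds ht.1 ht.2), ← fderiv_apply_one_eq_deriv,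
              ← mfderiv_eq_fderiv, e1]
            rfl
          have e3 : g.inner (γ t) v v = gramForm g c (φ (γ t)) w w := 
            (gramForm_mfderiv_chart g ht'.1 v).symm
          rw [e2]
          refine le_of_le_of_eq (b := (C : ℝ≥0∞) * ENNReal.ofReal √(g.inner (γ t) v v)) ?_
            (congrArg _ (enorm_tangentSpace g _ v).symm)
          rw [← ofReal_norm, ← ENNReal.ofReal_coe_nnreal (p := C),
            ← ENNReal.ofReal_mul C.coe_nonneg, e3]
          refine ENNReal.ofReal_le_ofReal ?_
          rw [← Real.sqrt_sq (norm_nonneg w), ← Real.sqrt_sq C.coe_nonneg,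
            ← Real.sqrt_mul (sq_nonneg _)]
          exact Real.sqrt_le_sqrt (ht'.2 w)
      _ = C * pathELength (𝓡 n) γ 0 1 := by
          rw [lintegral_const_mul' _ _ ENNReal.coe_ne_top, pathELength_eq_lintegral_mfderiv_Ioo]
          rfl
      _ ≤ C * r := by gcongr
  have : (𝓝[>] riemEDist g x y).NeBot := nhdsGT_neBot_of_exists_gt ⟨_, hxy⟩
  refine ge_of_tendsto (x := 𝓝[>] riemEDist g x y) (f := fun r => (C : ℝ≥0∞) * r)
    ((ENNReal.continuous_const_mul ENNReal.coe_ne_top).continuousAt.tendsto.mono_left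
      nhdsWithin_le_nhds) ?_
  filter_upwards [Ioc_mem_nhdsGT hxy] with r hr using main r hr.1 hr.2

end Paths

/-! ### The Riemannian measure, and the `L^q` bound for the weights. -/

section RiemVolume

variable {n : ℕ} {M : Type*} [TopologicalSpace M]
  [ChartedSpace (EuclideanSpace ℝ (Fin n)) M] [IsManifold (𝓡 n) ∞ M]
  [MeasurableSpace M] [BorelSpace M]

omit [IsManifold (𝓡 n) ∞ M] in
theorem aemeasurable_chart_symm (c : M) :
    AEMeasurable (chartAt (EuclideanSpace ℝ (Fin n)) c).symm
      (volume.restrict (chartAt (EuclideanSpace ℝ (Fin n)) c).target) :=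
  (chartAt (EuclideanSpace ℝ (Fin n)) c).continuousOn_symm.aemeasurable
    (chartAt (EuclideanSpace ℝ (Fin n)) c).open_target.measurableSet

omit [MeasurableSpace M] [BorelSpace M] in
theorem aemeasurable_volumeDensity (g : SmoothMetric n M) (c : M) :
    AEMeasurable (fun z => ENNReal.ofReal √(gramMatrix g c z).det)
      (volume.restrict (chartAt (EuclideanSpace ℝ (Fin n)) c).target) :=
  (ENNReal.continuous_ofReal.comp_continuousOn
    (Real.continuous_sqrt.comp_continuousOn (continuousOn_gramMatrix_det g c))).aemeasurable
    (chartAt (EuclideanSpace ℝ (Fin n)) c).open_target.measurableSet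

theorem lintegral_chartVolume (g : SmoothMetric n M) (c : M) {h : M → ℝ≥0∞} (hh : Measurable h) :
    ∫⁻ x, h x ∂(chartVolume g c) =
      ∫⁻ z in (chartAt (EuclideanSpace ℝ (Fin n)) c).target,
        ENNReal.ofReal √(gramMatrix g c z).det *
          h ((chartAt (EuclideanSpace ℝ (Fin n)) c).symm z) := by
  have h1 := aemeasurable_chart_symm (n := n) c
  have h2 := aemeasurable_volumeDensity g c
  rw [chartVolume, lintegral_map' hh.aemeasurable
    (h1.mono_ac (withDensity_absolutelyContinuous _ _)),
    lintegral_withDensity_eq_lintegral_mul₀ h2 (g := fun z => h ((chartAt _ c).symm z))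
      (hh.comp_aemeasurable h1)]
  rfl

variable [T2Space M] [CompactSpace M]

theorem measurable_chartPartition (c : M) :
    Measurable fun y => ENNReal.ofReal (chartPartition n M c y) :=
  (ENNReal.continuous_ofReal.comp (chartPartition n M c).contMDiff.continuous).measurable

theorem lintegral_riemVolume (g : SmoothMetric n M) {h : M → ℝ≥0∞} (hh : Measurable h) :
    ∫⁻ x, h x ∂(riemVolume g) =
      ∑' c : M, ∫⁻ z in (chartAt (EuclideanSpace ℝ (Fin n)) c).target,
        ENNReal.ofReal √(gramMatrix g c z).det *
          (ENNReal.ofReal (chartPartition n M c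
            ((chartAt (EuclideanSpace ℝ (Fin n)) c).symm z)) *
          h ((chartAt (EuclideanSpace ℝ (Fin n)) c).symm z)) := by
  rw [riemVolume, lintegral_sum_measure]
  refine tsum_congr fun c => ?_
  rw [lintegral_withDensity_eq_lintegral_mul _ (measurable_chartPartition c) hh,
    lintegral_chartVolume g c ((measurable_chartPartition c).mul hh)]
  rfl

omit [T2Space M] [CompactSpace M] [IsManifold (𝓡 n) ∞ M] in
theorem measurable_weight (f : C^∞⟮𝓡 n, M; 𝓘(ℝ, ℝ), ℝ⟯) :
    Measurable fun x => ENNReal.ofReal (Real.exp (n * f x)) :=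
  (ENNReal.continuous_ofReal.comp
    (Real.continuous_exp.comp (continuous_const.mul f.contMDiff.continuous))).measurable

/-- Both measures use the same charts and partition of unity, so the densities are compared chart by
chart. -/
theorem riemVolume_conformal_univ (g : SmoothMetric n M) (f : C^∞⟮𝓡 n, M; 𝓘(ℝ, ℝ), ℝ⟯) :
    riemVolume (conformal g f) univ =
      ∫⁻ x, ENNReal.ofReal (Real.exp (n * f x)) ∂(riemVolume g) := by
  rw [← lintegral_one, lintegral_riemVolume _ measurable_const,
    lintegral_riemVolume _ (measurable_weight f)]
  refine tsum_congr fun c => setLIntegral_congr_fun (chartAt _ c).open_target.measurableSet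
    fun z _ => ?_
  simp only [gramMatrix_conformal_det]
  rw [ENNReal.ofReal_mul (Real.exp_pos _).le]
  ring

/-- Around every point there is a chart in which the Riemannian measure dominates a multiple of
Lebesgue measure. -/
theorem exists_lintegral_ball_le (g : SmoothMetric n M) (p : M) :
    ∃ c : M, p ∈ (chartAt (EuclideanSpace ℝ (Fin n)) c).source ∧ ∃ B : ℝ≥0, ∃ R > 0,
      Metric.ball (chartAt (EuclideanSpace ℝ (Fin n)) c p) R ⊆
        (chartAt (EuclideanSpace ℝ (Fin n)) c).target ∧
      ∀ h : M → ℝ≥0∞, Measurable h →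
        ∫⁻ z in Metric.ball (chartAt (EuclideanSpace ℝ (Fin n)) c p) R,
          h ((chartAt (EuclideanSpace ℝ (Fin n)) c).symm z) ≤
        B * ∫⁻ x, h x ∂(riemVolume g) := by
  -- The chart must be one whose partition function is positive at `p`, perhaps not the preferred
  -- chart there. That single term of the sum already has a density bounded below near `p`.
  obtain ⟨c, hc⟩ := (chartPartition n M).exists_pos_of_mem (mem_univ p)
  have hsub : (chartPartition n M).IsSubordinate fun x : M => (chartAt _ x).source :=
    (SmoothPartitionOfUnity.exists_isSubordinate_chartAt_source (𝓡 n) M).choose_spec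
  have hp : p ∈ (chartAt (EuclideanSpace ℝ (Fin n)) c).source :=
    hsub c (subset_tsupport _ hc.ne')
  refine ⟨c, hp, ?_⟩
  set φ := chartAt (EuclideanSpace ℝ (Fin n)) c with hφ
  have hz := φ.map_source hp
  set d : EuclideanSpace ℝ (Fin n) → ℝ :=
    fun z => √(gramMatrix g c z).det * chartPartition n M c (φ.symm z) with hd
  have hdc : ContinuousAt d (φ p) := by
    refine ContinuousAt.mul ?_ ?_
    · exact (Real.continuous_sqrt.comp_continuousOn (continuousOn_gramMatrix_det g c)).continuousAt
        (φ.open_target.mem_nhds hz)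
    · exact (chartPartition n M c).contMDiff.continuous.continuousAt.comp (φ.continuousAt_symm hz)
  have hd0 : 0 < d (φ p) := by
    refine mul_pos (Real.sqrt_pos.2 (gramMatrix_posDef g hz).det_pos) ?_
    rwa [φ.left_inv hp]
  obtain ⟨R, hR, hball⟩ := Metric.mem_nhds_iff.1
    ((φ.open_target.eventually_mem hz).and (hdc.eventually_const_lt (half_lt_self hd0)))
  refine ⟨(d (φ p) / 2)⁻¹.toNNReal, R, hR, fun z hz => (hball hz).1, fun h hh => ?_⟩
  have key : ENNReal.ofReal (d (φ p) / 2) * ∫⁻ z in Metric.ball (φ p) R, h (φ.symm z) ≤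
      ∫⁻ x, h x ∂(riemVolume g) := by
    rw [lintegral_riemVolume g hh]
    refine le_trans ?_ (ENNReal.le_tsum c)
    rw [← lintegral_const_mul' _ _ ENNReal.ofReal_ne_top]
    refine (setLIntegral_mono' Metric.isOpen_ball.measurableSet fun z hz => ?_).trans
      (lintegral_mono_set fun z hz => (hball hz).1)
    rw [← mul_assoc, ← ENNReal.ofReal_mul (Real.sqrt_nonneg _)]
    gcongr
    exact (hball hz).2.le
  have hpos : 0 < d (φ p) / 2 := half_pos hd0
  calc _ = ENNReal.ofReal (d (φ p) / 2)⁻¹ * (ENNReal.ofReal (d (φ p) / 2) *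
        ∫⁻ z in Metric.ball (φ p) R, h (φ.symm z)) := by
        rw [← mul_assoc, ← ENNReal.ofReal_mul (by positivity), inv_mul_cancel₀ hpos.ne']
        simp
    _ ≤ _ := by
        gcongr
        exact le_rfl

variable [ConnectedSpace M]

omit [MeasurableSpace M] [BorelSpace M] in
theorem isOpen_geodesicBall (g : SmoothMetric n M) (x : M) (r : ℝ) :
    IsOpen (geodesicBall g x r) := by
  have : Continuous fun y : RiemSpace g => dist (show RiemSpace g from x) y :=
    continuous_const.dist continuous_id
  exact isOpen_lt (β := RiemSpace g) this continuous_const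

omit [MeasurableSpace M] [BorelSpace M] [ConnectedSpace M] in
theorem mem_geodesicBall_self (g : SmoothMetric n M) (x : M) {r : ℝ} (hr : 0 < r) :
    x ∈ geodesicBall g x r := by
  change riemDist g x x < r
  rw [riemDist, riemEDist_self]
  simpa using hr

/-- By compactness `e^{nf}` has a positive minimum, so the finite volume of `g_f` bounds that of
`g`. -/
theorem isFiniteMeasure_riemVolume (g : SmoothMetric n M) (f : C^∞⟮𝓡 n, M; 𝓘(ℝ, ℝ), ℝ⟯)
    (hf : riemVolume (conformal g f) univ < ⊤) : IsFiniteMeasure (riemVolume g) := by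
  obtain ⟨x₀, -, hx₀⟩ := isCompact_univ.exists_isMinOn univ_nonempty
    (Real.continuous_exp.comp ((continuous_const (y := (n : ℝ))).mul
      f.contMDiff.continuous)).continuousOn
  refine ⟨?_⟩
  rw [riemVolume_conformal_univ] at hf
  have h1 : ENNReal.ofReal (Real.exp (n * f x₀)) * riemVolume g univ ≤
      ∫⁻ x, ENNReal.ofReal (Real.exp (n * f x)) ∂(riemVolume g) := by
    rw [← lintegral_const]
    exact lintegral_mono fun x => ENNReal.ofReal_le_ofReal (hx₀ (mem_univ x))
  refine ENNReal.lt_top_of_mul_ne_top_right (h1.trans_lt hf).ne ?_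
  simpa using Real.exp_pos _

/-- The weights of the conformal class are bounded in `L^q`. -/
theorem exists_lintegral_weight_le (g : SmoothMetric n M) (V C : ℝ) {R₀ q : ℝ}
    (hV : 0 < V) (hR₀ : 0 < R₀) (hq : 1 < q) (hC : 0 < C) :
    ∃ A : ℝ≥0∞, A < ⊤ ∧ ∀ f ∈ conformalClass g V R₀ q C,
      ∫⁻ x, ENNReal.ofReal (Real.exp (n * f x) ^ q) ∂(riemVolume g) ≤ A := by
  obtain ⟨s, -, hs⟩ := isCompact_univ.elim_nhds_subcover (fun x : M => geodesicBall g x R₀)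
    fun x _ => (isOpen_geodesicBall g x R₀).mem_nhds (mem_geodesicBall_self g x hR₀)
  let m : M → ℝ := fun x => (riemVolume g).real (geodesicBall g x R₀)
  -- On a ball of measure `m`, reverse Hölder and `∫ w ≤ V` give `∫ w^q ≤ m * (C * V / m) ^ q`. The
  -- cover depends only on `g` and `R₀`, so the sum is independent of `f`.
  refine ⟨∑ x ∈ s, ENNReal.ofReal (m x * (C * ((m x)⁻¹ * V)) ^ q), by simp, fun f hf => ?_⟩
  have hfin : IsFiniteMeasure (riemVolume g) :=
    isFiniteMeasure_riemVolume g f (hf.1.trans_lt ENNReal.ofReal_lt_top)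
  have hcont : Continuous fun x => Real.exp (n * f x) :=
    Real.continuous_exp.comp (continuous_const.mul f.contMDiff.continuous)
  have hcontq : Continuous fun x => Real.exp (n * f x) ^ q :=
    hcont.rpow_const fun x => Or.inl (Real.exp_pos _).ne'
  have hint : ∀ u : M → ℝ, Continuous u → Integrable u (riemVolume g) := by
    intro u hu
    obtain ⟨b, hb⟩ := (isCompact_range hu).isBounded.exists_norm_le
    exact Integrable.of_bound hu.aestronglyMeasurable b
      (Eventually.of_forall fun x => hb _ (mem_range_self x))
  have hVint : ∫ x, Real.exp (n * f x) ∂(riemVolume g) ≤ V := by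
    have h1 := hf.1
    rw [riemVolume_conformal_univ, ← ofReal_integral_eq_lintegral_ofReal (hint _ hcont)
      (Eventually.of_forall fun x => (Real.exp_pos _).le)] at h1
    exact (ENNReal.ofReal_le_ofReal_iff hV.le).1 h1
  have hball : ∀ x, ∫⁻ y in geodesicBall g x R₀, ENNReal.ofReal (Real.exp (n * f y) ^ q)
      ∂(riemVolume g) ≤ ENNReal.ofReal (m x * (C * ((m x)⁻¹ * V)) ^ q) := by
    intro x
    set B := geodesicBall g x R₀ with hB
    -- A null ball contributes nothing, so positivity of the measures of balls is not needed.
    rcases eq_or_ne (riemVolume g B) 0 with h0 | h0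
    · rw [Measure.restrict_eq_zero.2 h0]
      simp
    have hm : 0 < m x := ENNReal.toReal_pos h0 (measure_ne_top _ _)
    rw [← ofReal_integral_eq_lintegral_ofReal (hint _ hcontq).integrableOn
      (Eventually.of_forall fun x => by positivity)]
    refine ENNReal.ofReal_le_ofReal ?_
    have h1 := hf.2 x R₀ hR₀ le_rfl
    rw [setAverage_eq, setAverage_eq, smul_eq_mul, smul_eq_mul] at h1
    change ((m x)⁻¹ * ∫ y in B, Real.exp (n * f y) ^ q ∂(riemVolume g)) ^ (1 / q) ≤
      C * ((m x)⁻¹ * ∫ y in B, Real.exp (n * f y) ∂(riemVolume g)) at h1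
    have hI : ∫ y in B, Real.exp (n * f y) ∂(riemVolume g) ≤ V :=
      (setIntegral_le_integral (hint _ hcont)
        (Eventually.of_forall fun x => (Real.exp_pos _).le)).trans hVint
    have hI0 : 0 ≤ ∫ y in B, Real.exp (n * f y) ^ q ∂(riemVolume g) :=
      integral_nonneg fun y => by positivity
    have h2 : ((m x)⁻¹ * ∫ y in B, Real.exp (n * f y) ^ q ∂(riemVolume g)) ^ (1 / q) ≤
        C * ((m x)⁻¹ * V) := h1.trans (by gcongr)
    have h3 := Real.rpow_le_rpow (by positivity) h2 (by linarith : 0 ≤ q)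
    rw [← Real.rpow_mul (by positivity), one_div, inv_mul_cancel₀ (by linarith), Real.rpow_one]
      at h3
    rwa [inv_mul_le_iff₀ hm] at h3
  calc ∫⁻ x, ENNReal.ofReal (Real.exp (n * f x) ^ q) ∂(riemVolume g)
      ≤ ∫⁻ y in ⋃ x ∈ s, geodesicBall g x R₀, ENNReal.ofReal (Real.exp (n * f y) ^ q)
        ∂(riemVolume g) := by
        rw [← setLIntegral_univ]
        exact lintegral_mono_set hs
    _ ≤ ∑ x ∈ s, ∫⁻ y in geodesicBall g x R₀, ENNReal.ofReal (Real.exp (n * f y) ^ q)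
        ∂(riemVolume g) := by
        rw [← Finset.sum_coe_sort, ← tsum_fintype (L := .unconditional s)]
        have := lintegral_iUnion_le (μ := riemVolume g) (fun x : s => geodesicBall g x R₀)
          fun y => ENNReal.ofReal (Real.exp (n * f y) ^ q)
        rwa [iUnion_subtype] at this
    _ ≤ _ := Finset.sum_le_sum fun x _ => hball x

end RiemVolume

/-! ### From a local to a global Hölder bound for the conformal distances. -/

section LocalToGlobal

/-- On a compact connected space, a function which satisfies the triangle inequality and is locally
bounded by a power of the distance is globally bounded by it. -/
theorem exists_forall_le_dist_rpow {X : Type*} [MetricSpace X] [CompactSpace X] [ConnectedSpace X]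
    (D : X → X → ℝ≥0∞) (hsymm : ∀ x y, D x y = D y x) (htri : ∀ x y z, D x z ≤ D x y + D y z)
    {β : ℝ} (hβ : 0 < β)
    (hloc : ∀ p, ∃ K < (⊤ : ℝ≥0∞), ∃ U ∈ 𝓝 p, ∀ x ∈ U, ∀ y ∈ U,
      D x y ≤ K * ENNReal.ofReal (dist x y ^ β)) :
    ∃ K < (⊤ : ℝ≥0∞), ∀ x y, D x y ≤ K * ENNReal.ofReal (dist x y ^ β) := by
  choose K hK U hU hDU using hloc
  have hself : ∀ p, p ∈ U p := fun p => mem_of_mem_nhds (hU p)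
  have hfin : ∀ p, ∀ x ∈ U p, D p x < ⊤ := fun p x hx =>
    (hDU p p (hself p) x hx).trans_lt (ENNReal.mul_lt_top (hK p) ENNReal.ofReal_lt_top)
  obtain ⟨x₀⟩ : Nonempty X := inferInstance
  -- `D` may a priori be infinite, being later a supremum over the whole class. Connectedness
  -- excludes this.
  have hclopen : IsClopen {y | D x₀ y < ⊤} := by
    refine ⟨isOpen_compl_iff.1 (isOpen_iff_mem_nhds.2 fun p hp => ?_),
      isOpen_iff_mem_nhds.2 fun p hp => ?_⟩
    · filter_upwards [hU p] with y hy hy'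
      refine hp ((htri x₀ y p).trans_lt (ENNReal.add_lt_top.2 ⟨hy', ?_⟩))
      rw [hsymm]
      exact hfin p y hy
    · filter_upwards [hU p] with y hy
      exact (htri x₀ p y).trans_lt (ENNReal.add_lt_top.2 ⟨hp, hfin p y hy⟩)
  have hx₀ : x₀ ∈ {y | D x₀ y < ⊤} := by
    have := hDU x₀ x₀ (hself x₀) x₀ (hself x₀)
    exact this.trans_lt (ENNReal.mul_lt_top (hK x₀) ENNReal.ofReal_lt_top)
  have hall : ∀ y, D x₀ y < ⊤ := fun y => by
    have := hclopen.eq_univ ⟨x₀, hx₀⟩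
    exact this.ge (mem_univ y)
  obtain ⟨s, -, hs⟩ := isCompact_univ.elim_nhds_subcover (fun p => interior (U p))
    fun p _ => interior_mem_nhds.2 (hU p)
  set d := Metric.diam (univ : Set X)
  have hd : ∀ x y : X, dist x y ≤ d := fun x y =>
    Metric.dist_le_diam_of_mem isCompact_univ.isBounded (mem_univ x) (mem_univ y)
  set b := ∑ p ∈ s, (D x₀ p + K p * ENNReal.ofReal (d ^ β)) with hb_def
  have hb : b < ⊤ := ENNReal.sum_lt_top.2 fun p _ => ENNReal.add_lt_top.2
    ⟨hall p, ENNReal.mul_lt_top (hK p) ENNReal.ofReal_lt_top⟩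
  have hDb : ∀ y, D x₀ y ≤ b := by
    intro y
    obtain ⟨p, hp, hy⟩ := mem_iUnion₂.1 (hs (mem_univ y))
    refine le_trans ?_ (Finset.single_le_sum
      (f := fun p => D x₀ p + K p * ENNReal.ofReal (d ^ β)) (fun _ _ => zero_le) hp)
    refine (htri x₀ p y).trans ?_
    gcongr
    refine (hDU p p (hself p) y (interior_subset hy)).trans ?_
    gcongr
    exact hd p y
  have hcover : (univ : Set X) ⊆ ⋃ p : s, interior (U p) := by
    rwa [iUnion_subtype]
  obtain ⟨δ, hδ, hleb⟩ := lebesgue_number_lemma_of_metric isCompact_univ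
    (fun p : s => isOpen_interior (s := U p)) hcover
  have hδβ : ENNReal.ofReal (δ ^ β) ≠ 0 := by
    simpa using Real.rpow_pos_of_pos hδ β
  -- Points closer than the Lebesgue number `δ` share some `U p`. For the others `D ≤ 2 * b`, and
  -- `dist x y ^ β ≥ δ ^ β`.
  refine ⟨∑ p ∈ s, K p + 2 * b * (ENNReal.ofReal (δ ^ β))⁻¹, ?_, fun x y => ?_⟩
  · refine ENNReal.add_lt_top.2 ⟨ENNReal.sum_lt_top.2 fun p _ => hK p, ?_⟩
    exact ENNReal.mul_lt_top (ENNReal.mul_lt_top (by simp) hb) (by simpa using pos_iff_ne_zero.2 hδβ)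
  rcases lt_or_ge (dist x y) δ with h | h
  · obtain ⟨p, hp⟩ := hleb x (mem_univ x)
    refine (hDU p x (interior_subset (hp (Metric.mem_ball_self hδ))) y
      (interior_subset (hp (Metric.mem_ball'.2 h)))).trans ?_
    gcongr
    exact (Finset.single_le_sum (f := K) (fun _ _ => zero_le) p.2).trans le_self_add
  · calc D x y ≤ b + b := by
          refine (htri x x₀ y).trans (add_le_add ?_ (hDb y))
          rw [hsymm]
          exact hDb x
      _ = 2 * b * (ENNReal.ofReal (δ ^ β))⁻¹ * ENNReal.ofReal (δ ^ β) := by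
          rw [mul_assoc, ENNReal.inv_mul_cancel hδβ ENNReal.ofReal_ne_top, mul_one, two_mul]
      _ ≤ _ := by
          gcongr
          exact le_add_self

variable {n : ℕ} {M : Type*} [TopologicalSpace M] [T2Space M] [CompactSpace M] [ConnectedSpace M]
  [ChartedSpace (EuclideanSpace ℝ (Fin n)) M] [IsManifold (𝓡 n) ∞ M]
  [MeasurableSpace M] [BorelSpace M]

/-- The local Hölder bound for conformal distances, whose weights are bounded in `L^q`. -/
theorem exists_nhds_riemEDist_conformal_le (hn : n ≠ 0) (g : SmoothMetric n M) {q : ℝ} (hq : 1 < q)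
    (S : Set C^∞⟮𝓡 n, M; 𝓘(ℝ, ℝ), ℝ⟯) {A : ℝ≥0∞} (hA : A < ⊤)
    (hS : ∀ f ∈ S, ∫⁻ x, ENNReal.ofReal (Real.exp (n * f x) ^ q) ∂(riemVolume g) ≤ A) (p : M) :
    ∃ K < (⊤ : ℝ≥0∞), ∃ U ∈ 𝓝 p, ∀ f ∈ S, ∀ x ∈ U, ∀ y ∈ U,
      riemEDist (conformal g f) x y ≤ K * ENNReal.ofReal (riemDist g x y ^ (1 - 1 / q)) := by
  obtain ⟨c, hp, B, R, hR, hball, hB⟩ := exists_lintegral_ball_le g p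
  set φ := chartAt (EuclideanSpace ℝ (Fin n)) c with hφ
  obtain ⟨L, hL0, hL⟩ := eventually_gramForm_bounds g (φ.map_source hp)
  obtain ⟨C, W, hW, hCW⟩ := exists_edist_chart_le g hp
  obtain ⟨R', hR', hRR'⟩ := Metric.mem_nhds_iff.1
    (Filter.inter_mem (Metric.ball_mem_nhds (φ p) hR) hL)
  have : Nonempty (Fin n) := ⟨⟨0, Nat.pos_of_ne_zero hn⟩⟩
  obtain ⟨K, hK, hmor⟩ := morrey (E := EuclideanSpace ℝ (Fin n)) volume hq
  rw [finrank_euclideanSpace_fin] at hmor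
  have hβ : 0 < 1 - 1 / q := by
    have : 1 / q < 1 := (div_lt_one (by linarith)).2 hq
    linarith
  have hnq : 0 < n * q := by positivity
  refine ⟨K * ((L : ℝ≥0∞) ^ (n * q) * (B * A)) ^ (1 / (n * q)) * ENNReal.ofReal (C ^ (1 - 1 / q)),
    ?_, φ.source ∩ φ ⁻¹' (Metric.ball (φ p) (R' / 8)) ∩ W, ?_, ?_⟩
  · refine ENNReal.mul_lt_top (ENNReal.mul_lt_top hK (ENNReal.rpow_lt_top_of_nonneg (by positivity)
      (ENNReal.mul_lt_top (ENNReal.rpow_lt_top_of_nonneg hnq.le ENNReal.coe_ne_top)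
        (ENNReal.mul_lt_top ENNReal.coe_lt_top hA)).ne)) ENNReal.ofReal_lt_top
  · exact inter_mem (inter_mem (φ.open_source.mem_nhds hp)
      ((φ.continuousAt hp).preimage_mem_nhds (Metric.ball_mem_nhds _ (by positivity)))) hW
  rintro f hf x ⟨⟨hxs, hxb⟩, hxW⟩ y ⟨⟨hys, hyb⟩, hyW⟩
  have hbt : Metric.ball (φ p) R' ⊆ φ.target := fun z hz => hball (hRR' hz).1
  set ψ : EuclideanSpace ℝ (Fin n) → ℝ≥0∞ :=
    fun z => L * ENNReal.ofReal (Real.exp (f (φ.symm z))) with hψ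
  -- Outside the chart target `φ.symm` is uncontrolled; cutting off makes the density measurable on
  -- the whole space.
  set h := (Metric.ball (φ p) R').indicator ψ with hh
  have hψc : ContinuousOn ψ (Metric.ball (φ p) R') := by
    refine (ENNReal.continuous_const_mul ENNReal.coe_ne_top).comp_continuousOn
      (ENNReal.continuous_ofReal.comp_continuousOn (Real.continuous_exp.comp_continuousOn ?_))
    exact f.contMDiff.continuous.comp_continuousOn (φ.continuousOn_symm.mono hbt)
  have hhm : Measurable h := by
    classical
    rw [hh, ← piecewise_eq_indicator]
    exact hψc.measurable_piecewise continuousOn_const Metric.isOpen_ball.measurableSet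
  have key := hmor h (fun y z => riemEDist (conformal g f) (φ.symm y) (φ.symm z)) (φ p) R' hhm
    (fun y _ y' _ z _ => by
      rw [riemEDist_comm _ (φ.symm y')]
      exact riemEDist_triangle _ _ _ _)
    (fun y hy z hz => by
      have hseg : ∀ t ∈ Ioc (0 : ℝ) 1, y + t • (z - y) ∈ Metric.ball (φ p) R' := fun t ht =>
        (convex_ball (φ p) R').add_smul_sub_mem hy hz ⟨ht.1.le, ht.2⟩
      refine (riemEDist_le_lintegral_segment _ c
        (((convex_ball (φ p) R').segment_subset hy hz).trans hbt)).trans ?_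
      rw [← lintegral_const_mul' _ _ ENNReal.ofReal_ne_top]
      refine setLIntegral_mono' measurableSet_Ioc fun t ht => ?_
      rw [hh, indicator_of_mem (hseg t ht), hψ, gramForm_conformal]
      set w := y + t • (z - y)
      have h1 := ((hRR' (hseg t ht)).2 (z - y)).1
      have h2 : √(Real.exp (2 * f (φ.symm w)) * gramForm g c w (z - y) (z - y)) ≤
          ‖z - y‖ * (L * Real.exp (f (φ.symm w))) := by
        refine Real.sqrt_le_iff.2 ⟨by positivity, ?_⟩
        have e : Real.exp (2 * f (φ.symm w)) = Real.exp (f (φ.symm w)) ^ 2 := by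
          rw [← Real.exp_nat_mul]
          norm_num
        rw [e]
        refine (mul_le_mul_of_nonneg_left h1 (sq_nonneg _)).trans_eq ?_
        ring
      refine (ENNReal.ofReal_le_ofReal h2).trans_eq ?_
      rw [ENNReal.ofReal_mul (norm_nonneg _), ENNReal.ofReal_mul L.coe_nonneg,
        ENNReal.ofReal_coe_nnreal])
    (φ x) hxb (φ y) hyb
  -- Here `(e^f)^{nq} = w^q`, so the Morrey exponent `n * q` is exactly what the `L^q` bound on the
  -- weight controls.
  have hint : ∫⁻ z in Metric.ball (φ p) R', h z ^ (n * q) ≤ (L : ℝ≥0∞) ^ (n * q) * (B * A) := by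
    calc ∫⁻ z in Metric.ball (φ p) R', h z ^ (n * q)
        = ∫⁻ z in Metric.ball (φ p) R', (L : ℝ≥0∞) ^ (n * q) *
          ENNReal.ofReal (Real.exp (n * f (φ.symm z)) ^ q) := by
          refine setLIntegral_congr_fun Metric.isOpen_ball.measurableSet fun z hz => ?_
          simp only [hh, indicator_of_mem hz, hψ]
          rw [ENNReal.mul_rpow_of_nonneg _ _ hnq.le,
            ENNReal.ofReal_rpow_of_nonneg (Real.exp_pos _).le hnq.le, ← Real.exp_mul,
            ← Real.exp_mul]
          congr 3
          ring
      _ = (L : ℝ≥0∞) ^ (n * q) * ∫⁻ z in Metric.ball (φ p) R',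
          ENNReal.ofReal (Real.exp (n * f (φ.symm z)) ^ q) :=
          lintegral_const_mul' _ _ (ENNReal.rpow_lt_top_of_nonneg hnq.le ENNReal.coe_ne_top).ne
      _ ≤ _ := by
          gcongr
          refine (lintegral_mono_set fun z hz => (hRR' hz).1).trans ?_
          refine (hB (fun x => ENNReal.ofReal (Real.exp (n * f x) ^ q)) ?_).trans ?_
          · exact (ENNReal.continuous_ofReal.comp ((Real.continuous_exp.comp
              (continuous_const.mul f.contMDiff.continuous)).rpow_const
                fun x => Or.inl (Real.exp_pos _).ne')).measurable
          · gcongr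
            exact hS f hf
  simp only [φ.left_inv hxs, φ.left_inv hys] at key
  have hdist : dist (φ x) (φ y) ≤ C * riemDist g x y := by
    have h1 := ENNReal.toReal_mono
      (ENNReal.mul_ne_top ENNReal.coe_ne_top (riemEDist_ne_top g x y)) (hCW x hxW y hyW)
    rwa [ENNReal.toReal_mul, ← dist_edist] at h1
  have hd0 : 0 ≤ riemDist g x y := ENNReal.toReal_nonneg
  calc riemEDist (conformal g f) x y
      ≤ K * ((L : ℝ≥0∞) ^ (n * q) * (B * A)) ^ (1 / (n * q)) *
        ENNReal.ofReal ((C * riemDist g x y) ^ (1 - 1 / q)) := by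
        refine key.trans ?_
        gcongr
    _ = _ := by
        rw [Real.mul_rpow C.coe_nonneg hd0, ENNReal.ofReal_mul (by positivity), mul_assoc _
          (ENNReal.ofReal _)]

/-- The global Hölder bound for conformal distances, whose weights are bounded in `L^q`. -/
theorem exists_riemDist_conformal_le (hn : n ≠ 0) (g : SmoothMetric n M) {q : ℝ} (hq : 1 < q)
    (S : Set C^∞⟮𝓡 n, M; 𝓘(ℝ, ℝ), ℝ⟯) {A : ℝ≥0∞} (hA : A < ⊤)
    (hS : ∀ f ∈ S, ∫⁻ x, ENNReal.ofReal (Real.exp (n * f x) ^ q) ∂(riemVolume g) ≤ A) :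
    ∃ K : ℝ≥0, ∀ f ∈ S, ∀ x y : M,
      riemDist (conformal g f) x y ≤ K * riemDist g x y ^ (1 - 1 / q) := by
  have hβ : 0 < 1 - 1 / q := by
    have : 1 / q < 1 := (div_lt_one (by linarith)).2 hq
    linarith
  have : ConnectedSpace (RiemSpace g) := inferInstanceAs (ConnectedSpace M)
  -- The supremum keeps symmetry and the triangle inequality, so bounding this one function yields a
  -- constant uniform in `f`.
  let D : M → M → ℝ≥0∞ := fun x y => ⨆ f ∈ S, riemEDist (conformal g f) x y
  have hle : ∀ f ∈ S, ∀ x y, riemEDist (conformal g f) x y ≤ D x y := fun f hf x y =>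
    le_iSup₂ (f := fun f (_ : f ∈ S) => riemEDist (conformal g f) x y) f hf
  have hsymm : ∀ x y, D x y = D y x := fun x y => by
    simp only [D, fun f => riemEDist_comm (conformal g f) x y]
  obtain ⟨K, hK, h⟩ : ∃ K < (⊤ : ℝ≥0∞), ∀ x y : M,
      D x y ≤ K * ENNReal.ofReal (riemDist g x y ^ (1 - 1 / q)) :=
    exists_forall_le_dist_rpow (X := RiemSpace g) D hsymm
      (fun x y z => iSup₂_le fun f hf => (riemEDist_triangle (M := M) _ x y z).trans
        (add_le_add (hle f hf x y) (hle f hf y z)))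
      hβ (fun p => by
        obtain ⟨K, hK, U, hU, h⟩ := exists_nhds_riemEDist_conformal_le hn g hq S hA hS p
        exact ⟨K, hK, U, hU, fun x hx y hy => iSup₂_le fun f hf => h f hf x hx y hy⟩)
  refine ⟨K.toNNReal, fun f hf x y => ?_⟩
  have h2 := ENNReal.toReal_mono (ENNReal.mul_ne_top hK.ne ENNReal.ofReal_ne_top)
    ((hle f hf x y).trans (h x y))
  have hd0 : 0 ≤ riemDist g x y := ENNReal.toReal_nonneg
  rwa [ENNReal.toReal_mul, ENNReal.toReal_ofReal (Real.rpow_nonneg hd0 _)] at h2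

end LocalToGlobal

/-! ### Compactness in Hölder spaces and in the Gromov–Hausdorff space. -/

section Compactness

theorem holderWith_of_dist_le {X : Type*} [PseudoMetricSpace X] {u : X → ℝ} {L β : ℝ≥0}
    (h : ∀ x y, dist (u x) (u y) ≤ L * dist x y ^ (β : ℝ)) : HolderWith L β u := by
  intro x y
  rw [edist_dist, edist_dist, ENNReal.ofReal_rpow_of_nonneg dist_nonneg β.coe_nonneg,
    ← ENNReal.ofReal_coe_nnreal, ← ENNReal.ofReal_mul L.coe_nonneg]
  exact ENNReal.ofReal_le_ofReal (h x y)

/-- Interpolation: split the increment of `u` as its powers `α/β` and `1 - α/β`, bounding the first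
by the `β`-Hölder condition and the second by the oscillation `m`. -/
theorem holderWith_of_dist_le_const {X : Type*} [PseudoMetricSpace X] {u : X → ℝ} {L α β m : ℝ≥0}
    (hβ : 0 < β) (hαβ : α ≤ β) (hL : HolderWith L β u) (hm : ∀ x y, dist (u x) (u y) ≤ m) :
    HolderWith (L ^ (α / β : ℝ) * m ^ (1 - α / β : ℝ)) α u := by
  intro x y
  have hβ' : (0 : ℝ) < β := hβ
  have hαβ' : (α : ℝ) ≤ β := hαβ
  have h0 : (0 : ℝ) ≤ α / β := by positivity
  have h1 : (0 : ℝ) ≤ 1 - α / β := by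
    rw [sub_nonneg, div_le_one hβ']
    exact hαβ'
  have hd : edist (u x) (u y) ≤ m := by
    rw [edist_nndist]
    exact_mod_cast hm x y
  calc edist (u x) (u y)
      = edist (u x) (u y) ^ (α / β : ℝ) * edist (u x) (u y) ^ (1 - α / β : ℝ) := by
        rw [← ENNReal.rpow_add_of_nonneg _ _ h0 h1]
        simp
    _ ≤ (L * edist x y ^ (β : ℝ)) ^ (α / β : ℝ) * (m : ℝ≥0∞) ^ (1 - α / β : ℝ) := by
        gcongr
        exact hL x y
    _ = _ := by
        rw [ENNReal.mul_rpow_of_nonneg _ _ h0, ← ENNReal.rpow_mul, mul_div_cancel₀ _ hβ'.ne',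
          ENNReal.coe_mul, ENNReal.coe_rpow_of_nonneg _ h0, ENNReal.coe_rpow_of_nonneg _ h1]
        ring

/-- Bounded subsets of `C^β` are relatively compact in `C^α` for `α < β`. -/
theorem isCompact_holderBall {X : Type*} [MetricSpace X] [CompactSpace X] {α β : ℝ≥0}
    (hαβ : α < β) (B L : ℝ≥0) :
    IsCompact {u : HolderSpace α X | (∀ x, |u x| ≤ B) ∧ HolderWith L β u} := by
  have hβ : 0 < β := pos_of_gt hαβ
  set A : Set (BoundedContinuousFunction X ℝ) := {u | (∀ x, |u x| ≤ B) ∧ HolderWith L β u} with hA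
  have hev : ∀ x, Continuous fun u : BoundedContinuousFunction X ℝ => u x := fun x =>
    (continuous_apply x).comp BoundedContinuousFunction.continuous_coe
  have hAc : IsCompact A := by
    refine BoundedContinuousFunction.arzela_ascoli₂ (Metric.closedBall 0 B)
      (isCompact_closedBall _ _) A ?_ (fun u x hu => by simpa using hu.1 x) ?_
    · have e : A = (⋂ x, {u | |u x| ≤ (B : ℝ)}) ∩
          ⋂ x, ⋂ y, {u | edist (u x) (u y) ≤ L * edist x y ^ (β : ℝ)} := by
        ext u
        simp only [hA, HolderWith, mem_inter_iff, mem_iInter, mem_ofPred_eq]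
      rw [e]
      refine (isClosed_iInter fun x => isClosed_le ?_ continuous_const).inter
        (isClosed_iInter fun x => isClosed_iInter fun y => isClosed_le ?_ continuous_const)
      · exact (hev x).abs
      · exact (hev x).edist (hev y)
    · refine Metric.equicontinuous_of_continuity_modulus (fun s => L * s ^ (β : ℝ)) ?_ _
        fun x y u => u.2.2.dist_le x y
      have h : ContinuousAt (fun s : ℝ => (L : ℝ) * s ^ (β : ℝ)) 0 :=
        continuousAt_const.mul (Real.continuousAt_rpow_const _ _ (Or.inr β.coe_nonneg))
      have := h.tendsto
      rwa [Real.zero_rpow (by exact_mod_cast hβ.ne'), mul_zero] at this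
  have hmem : ∀ u ∈ A, MemHolder α u := fun u hu =>
    (holderWith_of_dist_le_const hβ hαβ.le hu.2 (m := 2 * B) fun x y => by
      have h1 := abs_sub (u x) (u y)
      have h2 := hu.1 x
      have h3 := hu.1 y
      rw [Real.dist_eq]
      push_cast
      linarith).memHolder
  -- `A` is compact for the sup norm. It remains to see that on `A` uniform convergence implies
  -- `C^α` convergence, by interpolating `v - u`, which is `β`-Hölder with constant `2 * L` and has
  -- oscillation at most twice the sup distance.
  let ι : A → HolderSpace α X := fun u => ⟨u.1, hmem u.1 u.2⟩
  have hι : Continuous ι := by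
    rw [continuous_iff_continuousAt]
    intro u
    rw [ContinuousAt, tendsto_iff_dist_tendsto_zero]
    set c : ℝ := (2 * L : ℝ) ^ (α / β : ℝ)
    have hexp : (0 : ℝ) < 1 - α / β := by
      rw [sub_pos, div_lt_one (by exact_mod_cast hβ)]
      exact hαβ
    have hb : ∀ v : A, dist (ι v) (ι u) ≤
        dist v u + c * (2 * dist v u) ^ (1 - α / β : ℝ) := by
      intro v
      have hsub : HolderWith (2 * L) β fun x => v.1 x - u.1 x := by
        refine holderWith_of_dist_le fun x y => (dist_sub_sub_le _ _ _ _).trans ?_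
        have h1 := v.2.2.dist_le x y
        have h2 := u.2.2.dist_le x y
        push_cast
        linarith
      have h1 := holderWith_of_dist_le_const hβ hαβ.le hsub (m := 2 * nndist v u) fun x y => by
        have h2 := BoundedContinuousFunction.dist_coe_le_dist (f := v.1) (g := u.1) x
        have h3 := BoundedContinuousFunction.dist_coe_le_dist (f := v.1) (g := u.1) y
        rw [Real.dist_eq] at h2 h3 ⊢
        have h4 := abs_sub (v.1 x - u.1 x) (v.1 y - u.1 y)
        push_cast
        have e : dist v u = dist v.1 u.1 := rfl
        linarith
      have h2 := h1.nnholderNorm_le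
      have h3 : (nnHolderNorm α (fun x => v.1 x - u.1 x) : ℝ) ≤
        c * (2 * dist v u) ^ (1 - α / β : ℝ) := by exact_mod_cast h2
      exact add_le_add le_rfl h3
    refine squeeze_zero (fun _ => dist_nonneg) hb ?_
    have hlim : ContinuousAt (fun s : ℝ => s + c * (2 * s) ^ (1 - α / β : ℝ)) 0 :=
      continuousAt_id.add (continuousAt_const.mul
        ((continuousAt_const.mul continuousAt_id).rpow_const (Or.inr hexp.le)))
    have h0 : (0 : ℝ) + c * (2 * 0) ^ (1 - α / β : ℝ) = 0 := by
      simp [Real.zero_rpow hexp.ne']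
    have hdist : Tendsto (fun v : A => dist v u) (𝓝 u) (𝓝 0) :=
      tendsto_iff_dist_tendsto_zero.1 tendsto_id
    have h2 := hlim.tendsto.comp hdist
    rwa [h0] at h2
  have : CompactSpace A := isCompact_iff_compactSpace.1 hAc
  convert isCompact_range hι
  ext u
  constructor
  · exact fun hu => ⟨⟨u.toFun, hu⟩, rfl⟩
  · rintro ⟨v, rfl⟩
    exact v.2

theorem exists_pos_mul_rpow_lt (K : ℝ) {β ε : ℝ} (hβ : 0 < β) (hε : 0 < ε) :
    ∃ δ > 0, ∀ s, 0 ≤ s → s < δ → K * s ^ β < ε := by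
  have h : ContinuousAt (fun s : ℝ => K * s ^ β) 0 :=
    continuousAt_const.mul (Real.continuousAt_rpow_const _ _ (Or.inr hβ.le))
  have h0 : (fun s : ℝ => K * s ^ β) 0 < ε := by simpa [Real.zero_rpow hβ.ne'] using hε
  obtain ⟨δ, hδ, hb⟩ := Metric.eventually_nhds_iff.1 (h.eventually_lt_const h0)
  refine ⟨δ, hδ, fun s hs hsδ => hb ?_⟩
  rwa [Real.dist_eq, sub_zero, abs_of_nonneg hs]

/-- Compact metric spaces which are images of a fixed one under bijections with a common Hölder
bound form a relatively compact subset of the Gromov-Hausdorff space. -/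
theorem isCompact_closure_toGHSpace {X : Type*} [MetricSpace X] [CompactSpace X] [Nonempty X]
    {ι : Type*} (Y : ι → Type*) [∀ i, MetricSpace (Y i)] [∀ i, CompactSpace (Y i)]
    [∀ i, Nonempty (Y i)] (φ : ∀ i, X → Y i) (hφ : ∀ i, Function.Surjective (φ i)) (K : ℝ≥0) {β : ℝ}
    (hβ : 0 < β) (h : ∀ i x y, dist (φ i x) (φ i y) ≤ K * dist x y ^ β) :
    IsCompact (closure (range fun i => GromovHausdorff.toGHSpace (Y i))) := by
  have hδ : ∀ k : ℕ, ∃ δ > 0, ∀ s, 0 ≤ s → s < δ → K * s ^ β < 1 / ((k : ℝ) + 1) := fun k =>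
    exists_pos_mul_rpow_lt K hβ (by positivity)
  choose δ hδ0 hδ using hδ
  -- The image of a finite `δ k`-net of `X` is a `1 / (k + 1)`-net of every `Y i`, of cardinality
  -- bounded independently of `i`.
  have ht : ∀ k : ℕ, ∃ t : Set X, t.Finite ∧ (univ : Set X) ⊆ ⋃ x ∈ t, Metric.ball x (δ k) :=
    fun k =>
    let ⟨t, _, h1, h2⟩ := Metric.finite_approx_of_totallyBounded
      (isCompact_univ (X := X)).totallyBounded (δ k) (hδ0 k)
    ⟨t, h1, h2⟩
  choose t htf htc using ht
  have e : ∀ i, Nonempty ((GromovHausdorff.toGHSpace (Y i)).Rep ≃ᵢ Y i) := fun i =>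
    GromovHausdorff.toGHSpace_eq_toGHSpace_iff_isometryEquiv.1
      (GromovHausdorff.GHSpace.toGHSpace_rep _)
  refine TotallyBounded.isCompact_of_isClosed (TotallyBounded.closure ?_) isClosed_closure
  refine GromovHausdorff.totallyBounded (u := fun k : ℕ => 1 / ((k : ℝ) + 1))
    (C := K * Metric.diam (univ : Set X) ^ β) (K := fun k => (htf k).toFinset.card)
    tendsto_one_div_add_atTop_nhds_zero_nat ?_ ?_
  · rintro - ⟨i, rfl⟩
    obtain ⟨e⟩ := e i
    rw [e.diam_univ]
    refine Metric.diam_le_of_forall_dist_le (by positivity) fun x _ y _ => ?_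
    obtain ⟨x, rfl⟩ := hφ i x
    obtain ⟨y, rfl⟩ := hφ i y
    refine (h i x y).trans ?_
    gcongr
    exact Metric.dist_le_diam_of_mem isCompact_univ.isBounded (mem_univ x) (mem_univ y)
  · rintro - ⟨i, rfl⟩ k
    obtain ⟨e⟩ := e i
    classical
    refine ⟨((htf k).toFinset.image fun x => e.symm (φ i x) : Finset _), ?_, fun z _ => ?_⟩
    · refine (Cardinal.mk_coe_finset (s := Finset.image _ _)).le.trans ?_
      exact_mod_cast Finset.card_image_le
    · obtain ⟨x, hx⟩ := hφ i (e z)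
      obtain ⟨a, ha, hxa⟩ := mem_iUnion₂.1 (htc k (mem_univ x))
      refine mem_iUnion₂.2 ⟨e.symm (φ i a), by simpa using ⟨a, ha, rfl⟩, ?_⟩
      rw [Metric.mem_ball, ← e.symm_apply_apply z, e.symm.dist_eq, ← hx]
      exact (h i x a).trans_lt (hδ k _ dist_nonneg hxa)

end Compactness

/-! ### Positivity of the dimension, and elementary properties of the distance. -/

section Main

variable {n : ℕ} {M : Type*} [TopologicalSpace M] [T2Space M] [CompactSpace M] [ConnectedSpace M]
  [ChartedSpace (EuclideanSpace ℝ (Fin n)) M] [IsManifold (𝓡 n) ∞ M]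

/-- A connected manifold of dimension `0` is discrete, hence a point. Thus `0 < R₀ ≤ diam` forces `n
≥ 1`, which Morrey's inequality needs. -/
theorem ne_zero_of_diam_pos (g : SmoothMetric n M)
    (h : 0 < Metric.diam (univ : Set (RiemSpace g))) : n ≠ 0 := by
  rintro rfl
  have hdisc : DiscreteTopology M := by
    refine discreteTopology_iff_isOpen_singleton.2 fun x => ?_
    convert (chartAt (EuclideanSpace ℝ (Fin 0)) x).open_source
    ext y
    refine ⟨fun hy => (show y = x from hy) ▸ mem_chart_source _ y, fun hy => ?_⟩
    exact (chartAt (EuclideanSpace ℝ (Fin 0)) x).injOn hy (mem_chart_source _ x)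
      (Subsingleton.elim _ _)
  have hsub : Subsingleton (RiemSpace g) := PreconnectedSpace.trivial_of_discrete (X := M)
  rw [Metric.diam_subsingleton subsingleton_of_subsingleton] at h
  exact lt_irrefl _ h

omit [T2Space M] [CompactSpace M] [ConnectedSpace M] in
theorem riemDist_nonneg (g : SmoothMetric n M) (x y : M) : 0 ≤ riemDist g x y :=
  ENNReal.toReal_nonneg

theorem abs_riemDist_sub_le (g : SmoothMetric n M) (x x' y y' : M) :
    |riemDist g x y - riemDist g x' y'| ≤ riemDist g x x' + riemDist g y y' := by
  have h := dist_dist_dist_le (α := RiemSpace g) x y x' y'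
  rwa [Real.dist_eq] at h

end Main

end ConformalGeometry

end

/-! ### The compactness theorem. -/

theorem mainTheorem11 {n : ℕ} {M : Type*} [TopologicalSpace M] [T2Space M] [CompactSpace M]
    [ConnectedSpace M] [ChartedSpace (EuclideanSpace ℝ (Fin n)) M] [IsManifold (𝓡 n) ∞ M]
    [MeasurableSpace M] [BorelSpace M]
    (g₀ : ConformalGeometry.SmoothMetric n M) (C V R₀ q : ℝ) (hC : 0 < C) (hV : 0 < V)
    (hR₀ : 0 < R₀) (hR₀' : R₀ ≤ Metric.diam (univ : Set (ConformalGeometry.RiemSpace g₀)))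
    (hq : 1 < q) :
    (∀ α : ℝ≥0, 0 < α → (α : ℝ) < 1 - 1 / q →
      (∀ f ∈ ConformalGeometry.conformalClass g₀ V R₀ q C,
        ∃ u : ConformalGeometry.HolderSpace α
            (ConformalGeometry.RiemSpace g₀ × ConformalGeometry.RiemSpace g₀),
          ∀ x y : M, u (x, y) =
            ConformalGeometry.riemDist (ConformalGeometry.conformal g₀ f) x y) ∧
      IsCompact (closure {u : ConformalGeometry.HolderSpace α
          (ConformalGeometry.RiemSpace g₀ × ConformalGeometry.RiemSpace g₀) |
        ∃ f ∈ ConformalGeometry.conformalClass g₀ V R₀ q C, ∀ x y : M, u (x, y) =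
          ConformalGeometry.riemDist (ConformalGeometry.conformal g₀ f) x y})) ∧
    IsCompact (closure {p : GromovHausdorff.GHSpace |
      ∃ f ∈ ConformalGeometry.conformalClass g₀ V R₀ q C,
        p = GromovHausdorff.toGHSpace
          (ConformalGeometry.RiemSpace (ConformalGeometry.conformal g₀ f))}) := by
  have hn := ConformalGeometry.ne_zero_of_diam_pos g₀ (hR₀.trans_le hR₀')
  obtain ⟨A, hA, hAf⟩ := ConformalGeometry.exists_lintegral_weight_le g₀ V C hV hR₀ hq hC
  obtain ⟨K, hK⟩ := ConformalGeometry.exists_riemDist_conformal_le hn g₀ hq _ hA hAf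
  have hβ : 0 < 1 - 1 / q := by
    have : 1 / q < 1 := (div_lt_one (by linarith)).2 hq
    linarith
  obtain ⟨β, hβq⟩ : ∃ β : ℝ≥0, (β : ℝ) = 1 - 1 / q := ⟨⟨_, hβ.le⟩, rfl⟩
  rw [← hβq] at hβ hK ⊢
  have hd0 : ∀ x y : M, 0 ≤ ConformalGeometry.riemDist g₀ x y :=
    ConformalGeometry.riemDist_nonneg g₀
  have hd : ∀ x y : M, ConformalGeometry.riemDist g₀ x y ≤
      Metric.diam (univ : Set (ConformalGeometry.RiemSpace g₀)) := fun x y =>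
    Metric.dist_le_diam_of_mem (α := ConformalGeometry.RiemSpace g₀) isCompact_univ.isBounded
      (mem_univ x) (mem_univ y)
  obtain ⟨B, hB⟩ : ∃ B : ℝ≥0, (B : ℝ) =
      K * Metric.diam (univ : Set (ConformalGeometry.RiemSpace g₀)) ^ (β : ℝ) :=
    ⟨⟨_, by positivity⟩, rfl⟩
  have hbound : ∀ f ∈ ConformalGeometry.conformalClass g₀ V R₀ q C, ∀ x y : M,
      |ConformalGeometry.riemDist (ConformalGeometry.conformal g₀ f) x y| ≤ B := by
    intro f hf x y
    rw [abs_of_nonneg (ConformalGeometry.riemDist_nonneg _ x y), hB]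
    refine (hK f hf x y).trans ?_
    have := hd0 x y
    gcongr
    exact hd x y
  -- The constant is `2 * K` because each of the two coordinates moves by at most the product
  -- distance, which is a maximum.
  have hholder : ∀ f ∈ ConformalGeometry.conformalClass g₀ V R₀ q C,
      ∀ z w : ConformalGeometry.RiemSpace g₀ × ConformalGeometry.RiemSpace g₀,
      dist (ConformalGeometry.riemDist (M := M) (ConformalGeometry.conformal g₀ f) z.1 z.2)
        (ConformalGeometry.riemDist (M := M) (ConformalGeometry.conformal g₀ f) w.1 w.2) ≤
        (2 * K : ℝ≥0) * dist z w ^ (β : ℝ) := by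
    rintro f hf ⟨x, y⟩ ⟨x', y'⟩
    have h1 := ConformalGeometry.abs_riemDist_sub_le (M := M)
      (ConformalGeometry.conformal g₀ f) x x' y y'
    have h2 : ∀ a b : ConformalGeometry.RiemSpace g₀, dist a b ≤ dist (x, y) (x', y') →
        ConformalGeometry.riemDist (M := M) (ConformalGeometry.conformal g₀ f) a b ≤
          K * dist (x, y) (x', y') ^ (β : ℝ) := fun a b hab =>
      (hK f hf a b).trans (mul_le_mul_of_nonneg_left
        (Real.rpow_le_rpow (hd0 a b) hab hβ.le) K.coe_nonneg)
    have h3 := h2 x x' (le_max_left _ _)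
    have h4 := h2 y y' (le_max_right _ _)
    rw [Real.dist_eq]
    push_cast
    exact h1.trans (by linarith)
  refine ⟨fun α hα hαβ => ⟨fun f hf => ?_, ?_⟩, ?_⟩
  · have hH := ConformalGeometry.holderWith_of_dist_le (hholder f hf)
    have hαβ' : α < β := hαβ
    let u : BoundedContinuousFunction
        (ConformalGeometry.RiemSpace g₀ × ConformalGeometry.RiemSpace g₀) ℝ :=
      BoundedContinuousFunction.mkOfCompact ⟨_, hH.continuous hβ⟩
    refine ⟨⟨u, (ConformalGeometry.holderWith_of_dist_le_const (m := 2 * B) hβ hαβ'.le hH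
      fun z w => ?_).memHolder⟩, fun x y => rfl⟩
    have h1 := hbound f hf z.1 z.2
    have h2 := hbound f hf w.1 w.2
    rw [Real.dist_eq]
    push_cast
    exact (abs_sub _ _).trans (by linarith)
  · refine (ConformalGeometry.isCompact_holderBall hαβ B (2 * K)).closure_of_subset ?_
    rintro u ⟨f, hf, hu⟩
    refine ⟨fun z => ?_, ConformalGeometry.holderWith_of_dist_le fun z w => ?_⟩
    · rw [show u z = _ from hu z.1 z.2]
      exact hbound f hf z.1 z.2
    · rw [show u z = _ from hu z.1 z.2, show u w = _ from hu w.1 w.2]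
      exact hholder f hf z w
  -- The bijections are the identity of `M`, viewed as a map from `(M, d_0)` to `(M, d_f)`.
  · have h := ConformalGeometry.isCompact_closure_toGHSpace (X := ConformalGeometry.RiemSpace g₀)
      (fun f : ConformalGeometry.conformalClass g₀ V R₀ q C =>
        ConformalGeometry.RiemSpace (ConformalGeometry.conformal g₀ f.1))
      (fun f x => x) (fun f x => ⟨x, rfl⟩) K hβ (fun f x y => hK f.1 f.2 x y)
    convert h
    ext p
    constructor
    · rintro ⟨f, hf, rfl⟩
      exact ⟨⟨f, hf⟩, rfl⟩
    · rintro ⟨f, rfl⟩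
      exact ⟨f.1, f.2, rfl⟩
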